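/- Let $\mathcal{E}\in(0,1)$, let $k=\sqrt{\frac{1-\mathcal{E}}{1+\mathcal{E}}}$, and let $$u_0(x)=\sqrt{1-\mathcal{E}}\;\mathrm{sn}\Bigl(x\sqrt{\tfrac{1+\mathcal{E}}{2}},\,k\Bigr),\qquad x\in\mathbb{R},$$ where $\mathrm{sn}$ is the Jacobi elliptic sine with modulus $k$; $u_0$ is a real solution of $u_0''+(1-u_0^2)u_0=0$ with period $2T_0=4\sqrt{\frac{2}{1+\mathcal{E}}}\,K(k)$, where $K$ is the complete elliptic integral of the first kind. For an interval $\mathcal{I}$ and $\psi:\mathcal I\to\mathbb{C}$ put $$E(\psi)=\int_{\mathcal I}\Bigl[|\psi_x|^2+\tfrac12(1-|\psi|^2)^2\Bigr]dx,\qquad Q(\psi)=\int_{\mathcal I}|\psi|^2\,dx,$$ $$R(\psi)=\int_{\mathcal I}\Bigl[|\psi_{xx}|^2+3|\psi|^2|\psi_x|^2+\tfrac12(\bar\psi\psi_x+\psi\bar\psi_x)^2+\tfrac12|\psi|^6\Bigr]dx,$$ $$S=R-\tfrac12(3-\mathcal{E}^2)\,Q,\qquad \Lambda_c=S-cE .$$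 Fix $c=2$. Then the second variation $\Lambda_2''(u_0)$ is positive except for the two neutral directions $u_0'$ and $iu_0$ due to translations and phase rotations, in the following sense. 1. Let $T=2NT_0$ with an integer $N\ge1$ and $\mathcal I=(0,T)$. For every complex-valued $w\in H^2_{\rm per}(0,T)$, $$\langle\Lambda_2''(u_0)w,w\rangle=\frac{d^2}{d\varepsilon^2}\Big|_{\varepsilon=0}\Lambda_2(u_0+\varepsilon w)\ \ge\ 0,$$ with equality if and only if $w=a\,u_0'+b\,iu_0$ for some $a,b\in\mathbb{R}$. 2. Let $\mathcal I=\mathbb{R}$, and let $\langle\Lambda_2''(u_0)w,\varphi\rangle$ be the integral over $\mathbb{R}$ of $\partial_s\partial_t|_{s=t=0}$ of the density of $\Lambda_2$ at $u_0+sw+t\varphi$. For every nonzero complex-valued $w\in H^2(\mathbb{R})$ one has $\langle\Lambda_2''(u_0)w,w\rangle>0$. 3. With the same form on $\mathbb{R}$, a complex-valued $w\in L^\infty(\mathbb{R})\cap H^2_{\rm loc}(\mathbb{R})$ satisfies $\langle\Lambda_2''(u_0)w,\varphi\rangle=0$ for all $\varphi\in C_c^\infty(\mathbb{R};\mathbb{C})$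 if and only if $w=a\,u_0'+b\,iu_0$ for some $a,b\in\mathbb{R}$. -/

import Mathlib

open MeasureTheory Set
open scoped ContDiff

noncomputable section

namespace CnoidalNLS

/-! ### Jacobi elliptic functions and the periodic wave profile -/

/-- Incomplete elliptic integral of the first kind, `F(φ, k) = ∫₀^φ dθ / √(1 - k² sin² θ)`. -/
def ellipticF (k φ : ℝ) : ℝ :=
  ∫ θ in (0 : ℝ)..φ, 1 / √(1 - k ^ 2 * Real.sin θ ^ 2)

/-- Complete elliptic integral of the first kind. -/
def ellipticK (k : ℝ) : ℝ := ellipticF k (Real.pi / 2)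

/-- Jacobi amplitude: for `0 ≤ k < 1` the map `φ ↦ F(φ, k)` is an increasing bijection of `ℝ`,
and `am(·, k)` is its inverse. -/
def jacobiAm (k ξ : ℝ) : ℝ := Function.invFun (ellipticF k) ξ

/-- Jacobi elliptic sine, `sn(ξ, k) = sin (am(ξ, k))`. -/
def jacobiSn (ξ k : ℝ) : ℝ := Real.sin (jacobiAm k ξ)

/-- The elliptic modulus `k = √((1 - ℰ) / (1 + ℰ))`. -/
def modulus (ℰ : ℝ) : ℝ := √((1 - ℰ) / (1 + ℰ))

/-- The periodic wave profile `u₀(x) = √(1 - ℰ) sn(x √((1 + ℰ) / 2), k)`. -/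
def profile (ℰ x : ℝ) : ℝ :=
  √(1 - ℰ) * jacobiSn (x * √((1 + ℰ) / 2)) (modulus ℰ)

/-- The period `2 T₀ = 4 √(2 / (1 + ℰ)) K(k)` of the profile. -/
def period (ℰ : ℝ) : ℝ := 4 * √(2 / (1 + ℰ)) * ellipticK (modulus ℰ)

/-- The profile as a complex-valued function. -/
def wave (ℰ : ℝ) : ℝ → ℂ := fun x => (profile ℰ x : ℂ)

/-! ### Sobolev spaces on the line

An element of a Sobolev space `H²` in one dimension is represented by its unique `C¹`
representative. -/

/-- `w ∈ H²_loc(ℝ)`: `w` is `C¹`, and `w'` is locally absolutely continuous (it is the integral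
of its almost everywhere derivative) with derivative in `L²_loc`. -/
structure MemH2Loc (w : ℝ → ℂ) : Prop where
  contDiff : ContDiff ℝ 1 w
  memLp : ∀ a b : ℝ, MemLp (deriv (deriv w)) 2 (volume.restrict (Icc a b))
  ftc : ∀ a b : ℝ, ∫ x in a..b, deriv (deriv w) x = deriv w b - deriv w a

/-- `w ∈ H²(ℝ)`. -/
structure MemH2 (w : ℝ → ℂ) : Prop extends MemH2Loc w where
  memLp_zero : MemLp w 2 volume
  memLp_one : MemLp (deriv w) 2 volume
  memLp_two : MemLp (deriv (deriv w)) 2 volume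

/-- `w ∈ H²_per(0, T)`, seen as a `T`-periodic function on `ℝ`. -/
structure MemH2Per (T : ℝ) (w : ℝ → ℂ) : Prop extends MemH2Loc w where
  periodic : Function.Periodic w T

/-! ### Conserved functionals

A density is a function of the values of `ψ`, `ψ_x`, `ψ_xx` at a point. -/

/-- `|ψ_x|² + (1 - |ψ|²)² / 2`. -/
def energyDensity (p p₁ _p₂ : ℂ) : ℝ := ‖p₁‖ ^ 2 + 1 / 2 * (1 - ‖p‖ ^ 2) ^ 2

/-- `|ψ|²`. -/
def chargeDensity (p _p₁ _p₂ : ℂ) : ℝ := ‖p‖ ^ 2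

/-- `|ψ_xx|² + 3 |ψ|² |ψ_x|² + (ψ̄ ψ_x + ψ ψ̄_x)² / 2 + |ψ|⁶ / 2`;
here `ψ̄ ψ_x + ψ ψ̄_x` is the real number `2 Re (ψ̄ ψ_x)`. -/
def higherDensity (p p₁ p₂ : ℂ) : ℝ :=
  ‖p₂‖ ^ 2 + 3 * ‖p‖ ^ 2 * ‖p₁‖ ^ 2 + 1 / 2 * (2 * (starRingEnd ℂ p * p₁).re) ^ 2
    + 1 / 2 * ‖p‖ ^ 6

/-- The density of `Λ_c = S - c E`, where `S = R - (3 - ℰ²) Q / 2`. -/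
def lyapunovDensity (ℰ c : ℝ) (p p₁ p₂ : ℂ) : ℝ :=
  (higherDensity p p₁ p₂ - 1 / 2 * (3 - ℰ ^ 2) * chargeDensity p p₁ p₂)
    - c * energyDensity p p₁ p₂

/-- The functional `ψ ↦ ∫_I F(ψ, ψ_x, ψ_xx) dx` with density `F`. -/
def functional (F : ℂ → ℂ → ℂ → ℝ) (I : Set ℝ) (ψ : ℝ → ℂ) : ℝ :=
  ∫ x in I, F (ψ x) (deriv ψ x) (deriv (deriv ψ) x)

/-- The energy `E`. -/
def energyE (I : Set ℝ) (ψ : ℝ → ℂ) : ℝ := functional energyDensity I ψ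

/-- The charge `Q`. -/
def chargeQ (I : Set ℝ) (ψ : ℝ → ℂ) : ℝ := functional chargeDensity I ψ

/-- The higher-order energy `R`. -/
def higherR (I : Set ℝ) (ψ : ℝ → ℂ) : ℝ := functional higherDensity I ψ

/-- `S = R - (3 - ℰ²) Q / 2`. -/
def higherS (ℰ : ℝ) (I : Set ℝ) (ψ : ℝ → ℂ) : ℝ :=
  higherR I ψ - 1 / 2 * (3 - ℰ ^ 2) * chargeQ I ψ

/-- `Λ_c = S - c E`. -/
def lyapunov (ℰ c : ℝ) (I : Set ℝ) (ψ : ℝ → ℂ) : ℝ :=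
  higherS ℰ I ψ - c * energyE I ψ

/-! ### Second variations at the wave profile -/

/-- The second variation `⟨Λ_c''(u₀) w, w⟩` of `Λ_c` on the space of `T`-periodic functions:
the second derivative at `ε = 0` of `ε ↦ Λ_c(u₀ + ε w)`, with integrals over `(0, T)`. -/
def secondVariationPer (ℰ c T : ℝ) (w : ℝ → ℂ) : ℝ :=
  iteratedDeriv 2 (fun ε : ℝ => lyapunov ℰ c (Ioo 0 T) (fun x => wave ℰ x + ε * w x)) 0

/-- The bilinear form `⟨Λ_c''(u₀) w, φ⟩` over the whole line. As `Λ_c(u₀)` itself diverges on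
the line, the second derivative at `u₀` in the directions `w`, `φ` is taken in the density,
before integrating over `ℝ`. -/
def secondVariationLine (ℰ c : ℝ) (w φ : ℝ → ℂ) : ℝ :=
  ∫ x, deriv (fun s : ℝ => deriv (fun t : ℝ =>
    lyapunovDensity ℰ c
      (wave ℰ x + s * w x + t * φ x)
      (deriv (wave ℰ) x + s * deriv w x + t * deriv φ x)
      (deriv (deriv (wave ℰ)) x + s * deriv (deriv w) x + t * deriv (deriv φ) x)) 0) 0

/-- The real span of the two neutral directions `u₀'` (translations) and `i u₀` (phase
rotations). -/
def IsNeutral (ℰ : ℝ) (w : ℝ → ℂ) : Prop :=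
  ∃ a b : ℝ, ∀ x, w x = a * deriv (wave ℰ) x + b * (Complex.I * wave ℰ x)

end CnoidalNLS

end

/-!
Since `u₀` is real, `Λ₂''(u₀)` decouples into a quadratic form in the real part of `w` and one in
its imaginary part. The density of each differs by a total derivative from a sum of two squares
`(P f)² + (Z f)²` with `P f = f'' + g f' + q f` and `Z f = r f' + s f`, where the coefficients are
smooth periodic functions built from `u₀`, `u₀'` and `u₀' / (1 - u₀²)`. The common kernel of `P`
and `Z` is spanned by `u₀'` for the real part and by `u₀` for the imaginary part.

For periodic or square-integrable perturbations the total derivative integrates to zero, so the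
forms are nonnegative and vanish only on these kernels, which contain no nonzero square-integrable
function. A bounded weak solution of `P* P f + Z* Z f = 0` is tested with `η⁴ f` for a cutoff `η` at
scale `R`: a Caccioppoli estimate for `f'` bounds the integral of `(P f)² + (Z f)²` over `[-R, R]`
by a multiple of `1 / R`, so that `f` again lies in the kernel.
-/

noncomputable section

namespace CnoidalNLS

open Filter

/-! ### The Jacobi elliptic functions and the wave profile -/

section Elliptic

variable {k : ℝ}

lemma one_sub_sq_mul_sin_sq_pos (hk : k ^ 2 < 1) (θ : ℝ) : 0 < 1 - k ^ 2 * Real.sin θ ^ 2 := by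
  nlinarith [Real.sin_sq_le_one θ, sq_nonneg k, sq_nonneg (Real.sin θ)]

lemma continuous_ellipticF_integrand (hk : k ^ 2 < 1) :
    Continuous fun θ : ℝ => 1 / √(1 - k ^ 2 * Real.sin θ ^ 2) :=
  continuous_const.div (by fun_prop) fun θ =>
    (Real.sqrt_pos.2 (one_sub_sq_mul_sin_sq_pos hk θ)).ne'

lemma one_le_ellipticF_integrand (hk : k ^ 2 < 1) (θ : ℝ) :
    1 ≤ 1 / √(1 - k ^ 2 * Real.sin θ ^ 2) := by
  rw [le_div_iff₀ (Real.sqrt_pos.2 (one_sub_sq_mul_sin_sq_pos hk θ)), one_mul, Real.sqrt_le_one]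
  nlinarith [sq_nonneg (k * Real.sin θ)]

lemma hasDerivAt_ellipticF (hk : k ^ 2 < 1) (φ : ℝ) :
    HasDerivAt (ellipticF k) (1 / √(1 - k ^ 2 * Real.sin φ ^ 2)) φ :=
  (continuous_ellipticF_integrand hk).integral_hasStrictDerivAt 0 φ |>.hasDerivAt

lemma continuous_ellipticF (hk : k ^ 2 < 1) : Continuous (ellipticF k) :=
  continuous_iff_continuousAt.2 fun φ => (hasDerivAt_ellipticF hk φ).continuousAt

lemma strictMono_ellipticF (hk : k ^ 2 < 1) : StrictMono (ellipticF k) :=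
  strictMono_of_hasDerivAt_pos (hasDerivAt_ellipticF hk) fun θ =>
    zero_lt_one.trans_le (one_le_ellipticF_integrand hk θ)

lemma ellipticF_zero : ellipticF k 0 = 0 := intervalIntegral.integral_same

lemma monotone_ellipticF_sub_id (hk : k ^ 2 < 1) : Monotone fun φ => ellipticF k φ - φ :=
  monotone_of_hasDerivAt_nonneg (fun φ => (hasDerivAt_ellipticF hk φ).sub (hasDerivAt_id φ))
    fun φ => sub_nonneg.2 (one_le_ellipticF_integrand hk φ)

lemma surjective_ellipticF (hk : k ^ 2 < 1) : Function.Surjective (ellipticF k) := by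
  have hmono : ∀ {a b}, a ≤ b → ellipticF k a - a ≤ ellipticF k b - b :=
    fun h => monotone_ellipticF_sub_id hk h
  have hzero : ellipticF k 0 = 0 := ellipticF_zero
  refine (continuous_ellipticF hk).surjective ?_ ?_
  · refine tendsto_atTop_mono' _ ?_ tendsto_id
    filter_upwards [eventually_ge_atTop 0] with φ hφ
    simp only [id]
    linarith [hmono hφ]
  · refine tendsto_atBot_mono' _ ?_ tendsto_id
    filter_upwards [eventually_le_atBot 0] with φ hφ
    simp only [id]
    linarith [hmono hφ]

lemma ellipticF_neg (φ : ℝ) : ellipticF k (-φ) = -ellipticF k φ := by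
  have h := intervalIntegral.integral_comp_neg (a := 0) (b := φ)
    fun θ : ℝ => 1 / √(1 - k ^ 2 * Real.sin θ ^ 2)
  simp only [Real.sin_neg, neg_sq, neg_zero] at h
  rw [ellipticF, intervalIntegral.integral_symm, ← h, ellipticF]

lemma ellipticF_add_pi (hk : k ^ 2 < 1) (φ : ℝ) :
    ellipticF k (φ + Real.pi) = ellipticF k φ + 2 * ellipticK k := by
  have hper : Function.Periodic (fun θ : ℝ => 1 / √(1 - k ^ 2 * Real.sin θ ^ 2)) Real.pi :=
    fun θ => by simp only [Real.sin_add_pi, neg_sq]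
  have hsub (a b : ℝ) : ellipticF k b - ellipticF k a
      = ∫ θ in a..b, 1 / √(1 - k ^ 2 * Real.sin θ ^ 2) :=
    intervalIntegral.integral_interval_sub_left
      ((continuous_ellipticF_integrand hk).intervalIntegrable _ _)
      ((continuous_ellipticF_integrand hk).intervalIntegrable _ _)
  have hshift := hper.intervalIntegral_add_eq φ (-(Real.pi / 2))
  rw [neg_add_eq_sub, sub_half, ← hsub, ← hsub, ellipticF_neg] at hshift
  rw [ellipticK]
  linarith

lemma ellipticK_pos (hk : k ^ 2 < 1) : 0 < ellipticK k := by
  simpa only [ellipticK, ellipticF_zero] using strictMono_ellipticF hk Real.pi_div_two_pos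

lemma ellipticF_jacobiAm (hk : k ^ 2 < 1) (ξ : ℝ) : ellipticF k (jacobiAm k ξ) = ξ :=
  Function.invFun_eq (surjective_ellipticF hk ξ)

lemma jacobiAm_ellipticF (hk : k ^ 2 < 1) (φ : ℝ) : jacobiAm k (ellipticF k φ) = φ :=
  Function.leftInverse_invFun (strictMono_ellipticF hk).injective φ

lemma jacobiAm_zero (hk : k ^ 2 < 1) : jacobiAm k 0 = 0 := by
  simpa only [ellipticF_zero] using jacobiAm_ellipticF hk 0

lemma jacobiAm_add_four_ellipticK (hk : k ^ 2 < 1) (ξ : ℝ) :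
    jacobiAm k (ξ + 4 * ellipticK k) = jacobiAm k ξ + 2 * Real.pi := by
  apply (strictMono_ellipticF hk).injective
  rw [ellipticF_jacobiAm hk, two_mul, ← add_assoc, ellipticF_add_pi hk, ellipticF_add_pi hk,
    ellipticF_jacobiAm hk]
  ring

lemma continuous_jacobiAm (hk : k ^ 2 < 1) : Continuous (jacobiAm k) := by
  have hmono : Monotone (jacobiAm k) := fun a b hab => by
    rwa [← (strictMono_ellipticF hk).le_iff_le, ellipticF_jacobiAm hk, ellipticF_jacobiAm hk]
  exact hmono.continuous_of_surjective fun φ => ⟨_, jacobiAm_ellipticF hk φ⟩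

/-- Jacobi elliptic cosine, `cn(ξ, k) = cos (am(ξ, k))`. -/
def jacobiCn (ξ k : ℝ) : ℝ := Real.cos (jacobiAm k ξ)

/-- Jacobi delta amplitude, `dn(ξ, k) = √(1 - k² sn(ξ, k)²)`. -/
def jacobiDn (ξ k : ℝ) : ℝ := √(1 - k ^ 2 * jacobiSn ξ k ^ 2)

lemma jacobiCn_sq (ξ k : ℝ) : jacobiCn ξ k ^ 2 = 1 - jacobiSn ξ k ^ 2 := Real.cos_sq' _

lemma jacobiDn_sq (hk : k ^ 2 < 1) (ξ : ℝ) : jacobiDn ξ k ^ 2 = 1 - k ^ 2 * jacobiSn ξ k ^ 2 :=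
  Real.sq_sqrt (one_sub_sq_mul_sin_sq_pos hk _).le

lemma jacobiDn_pos (hk : k ^ 2 < 1) (ξ : ℝ) : 0 < jacobiDn ξ k :=
  Real.sqrt_pos.2 (one_sub_sq_mul_sin_sq_pos hk _)

lemma jacobiSn_zero (hk : k ^ 2 < 1) : jacobiSn 0 k = 0 := by
  rw [jacobiSn, jacobiAm_zero hk, Real.sin_zero]

lemma hasDerivAt_jacobiAm (hk : k ^ 2 < 1) (ξ : ℝ) : HasDerivAt (jacobiAm k) (jacobiDn ξ k) ξ := by
  simpa only [one_div, inv_inv, jacobiDn, jacobiSn] using HasDerivAt.of_local_left_inverse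
    (continuous_jacobiAm hk).continuousAt (hasDerivAt_ellipticF hk (jacobiAm k ξ))
    (one_div_pos.2 (jacobiDn_pos hk ξ)).ne' (Eventually.of_forall (ellipticF_jacobiAm hk))

lemma hasDerivAt_jacobiSn (hk : k ^ 2 < 1) (ξ : ℝ) :
    HasDerivAt (jacobiSn · k) (jacobiCn ξ k * jacobiDn ξ k) ξ :=
  (hasDerivAt_jacobiAm hk ξ).sin

lemma hasDerivAt_jacobiCn (hk : k ^ 2 < 1) (ξ : ℝ) :
    HasDerivAt (jacobiCn · k) (-jacobiSn ξ k * jacobiDn ξ k) ξ :=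
  (hasDerivAt_jacobiAm hk ξ).cos

lemma hasDerivAt_jacobiDn (hk : k ^ 2 < 1) (ξ : ℝ) :
    HasDerivAt (jacobiDn · k) (-(k ^ 2 * jacobiSn ξ k * jacobiCn ξ k)) ξ := by
  refine (((((hasDerivAt_jacobiSn hk ξ).fun_pow 2).const_mul (k ^ 2)).const_sub 1).sqrt
    (one_sub_sq_mul_sin_sq_pos hk _).ne').congr_deriv ?_
  have hne := (jacobiDn_pos hk ξ).ne'
  rw [← jacobiDn]
  push_cast
  field_simp

lemma hasDerivAt_jacobiCn_mul_jacobiDn (hk : k ^ 2 < 1) (ξ : ℝ) :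
    HasDerivAt (fun ξ => jacobiCn ξ k * jacobiDn ξ k)
      (2 * k ^ 2 * jacobiSn ξ k ^ 3 - (1 + k ^ 2) * jacobiSn ξ k) ξ :=
  ((hasDerivAt_jacobiCn hk ξ).mul (hasDerivAt_jacobiDn hk ξ)).congr_deriv <| by
    linear_combination (-jacobiSn ξ k) * jacobiDn_sq hk ξ
      - k ^ 2 * jacobiSn ξ k * jacobiCn_sq ξ k

lemma jacobiSn_add_four_ellipticK (hk : k ^ 2 < 1) (ξ : ℝ) :
    jacobiSn (ξ + 4 * ellipticK k) k = jacobiSn ξ k := by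
  rw [jacobiSn, jacobiAm_add_four_ellipticK hk, Real.sin_add_two_pi, jacobiSn]

end Elliptic

section Profile

/-- The data of a real periodic wave `U` with derivative `V`: a solution of `U'' + (1 - U²) U = 0`
with first integral `U'² = ((1 - U²)² - ℰ²) / 2`, oscillating in `U² ≤ 1 - ℰ` and vanishing at the
origin. -/
structure IsCnoidal (ℰ T : ℝ) (U V : ℝ → ℝ) : Prop where
  pos : 0 < ℰ
  lt_one : ℰ < 1
  period_pos : 0 < T
  hasDerivAt : ∀ x, HasDerivAt U (V x) x
  hasDerivAt' : ∀ x, HasDerivAt V (U x ^ 3 - U x) x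
  first_integral : ∀ x, V x ^ 2 = ((1 - U x ^ 2) ^ 2 - ℰ ^ 2) / 2
  le : ∀ x, ℰ ≤ 1 - U x ^ 2
  zero : U 0 = 0
  periodic : Function.Periodic U T

variable {ℰ : ℝ}

lemma modulus_sq (h₀ : 0 < ℰ) (h₁ : ℰ < 1) : modulus ℰ ^ 2 = (1 - ℰ) / (1 + ℰ) :=
  Real.sq_sqrt (div_nonneg (by linarith) (by linarith))

lemma modulus_sq_lt_one (h₀ : 0 < ℰ) (h₁ : ℰ < 1) : modulus ℰ ^ 2 < 1 := by
  rw [modulus_sq h₀ h₁, div_lt_one (by linarith)]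
  linarith

/-- The derivative `u₀' = √(1 - ℰ) √((1 + ℰ) / 2) cn dn` of the profile. -/
def profileDeriv (ℰ x : ℝ) : ℝ :=
  √(1 - ℰ) * √((1 + ℰ) / 2) *
    (jacobiCn (x * √((1 + ℰ) / 2)) (modulus ℰ) * jacobiDn (x * √((1 + ℰ) / 2)) (modulus ℰ))

lemma hasDerivAt_profile (h₀ : 0 < ℰ) (h₁ : ℰ < 1) (x : ℝ) :
    HasDerivAt (profile ℰ) (profileDeriv ℰ x) x :=
  (((hasDerivAt_jacobiSn (modulus_sq_lt_one h₀ h₁) _).comp x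
    ((hasDerivAt_id x).mul_const √((1 + ℰ) / 2))).const_mul √(1 - ℰ)).congr_deriv <| by
      rw [profileDeriv, id]
      ring

lemma hasDerivAt_profileDeriv (h₀ : 0 < ℰ) (h₁ : ℰ < 1) (x : ℝ) :
    HasDerivAt (profileDeriv ℰ) (profile ℰ x ^ 3 - profile ℰ x) x := by
  refine (((hasDerivAt_jacobiCn_mul_jacobiDn (modulus_sq_lt_one h₀ h₁) _).comp x
    ((hasDerivAt_id x).mul_const √((1 + ℰ) / 2))).const_mul
      (√(1 - ℰ) * √((1 + ℰ) / 2))).congr_deriv ?_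
  have hA : √(1 - ℰ) ^ 2 = 1 - ℰ := Real.sq_sqrt (by linarith)
  have hκ : √((1 + ℰ) / 2) ^ 2 = (1 + ℰ) / 2 := Real.sq_sqrt (by linarith)
  have hkκ : modulus ℰ ^ 2 * √((1 + ℰ) / 2) ^ 2 = (1 - ℰ) / 2 := by
    rw [modulus_sq h₀ h₁, hκ]
    field_simp
  rw [profile, id]
  set S := jacobiSn (x * √((1 + ℰ) / 2)) (modulus ℰ)
  linear_combination √(1 - ℰ) * ((2 * S ^ 3 - S) * hkκ - S * hκ - S ^ 3 * hA)

lemma profileDeriv_sq (h₀ : 0 < ℰ) (h₁ : ℰ < 1) (x : ℝ) :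
    profileDeriv ℰ x ^ 2 = ((1 - profile ℰ x ^ 2) ^ 2 - ℰ ^ 2) / 2 := by
  rw [profileDeriv, profile, mul_pow, mul_pow, mul_pow, mul_pow, jacobiCn_sq,
    jacobiDn_sq (modulus_sq_lt_one h₀ h₁), modulus_sq h₀ h₁, Real.sq_sqrt (by linarith),
    Real.sq_sqrt (by linarith)]
  field_simp
  ring

lemma profile_sq_le (h₁ : ℰ < 1) (x : ℝ) : profile ℰ x ^ 2 ≤ 1 - ℰ := by
  rw [profile, mul_pow, Real.sq_sqrt (by linarith)]
  exact mul_le_of_le_one_right (by linarith) (Real.sin_sq_le_one _)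

lemma period_mul_sqrt (h₀ : 0 < ℰ) : period ℰ * √((1 + ℰ) / 2) = 4 * ellipticK (modulus ℰ) := by
  have hinv : √(2 / (1 + ℰ)) * √((1 + ℰ) / 2) = 1 := by
    rw [← inv_div, Real.sqrt_inv, inv_mul_cancel₀ (Real.sqrt_pos.2 (by linarith)).ne']
  rw [period]
  linear_combination 4 * ellipticK (modulus ℰ) * hinv

lemma profile_periodic (h₀ : 0 < ℰ) (h₁ : ℰ < 1) : Function.Periodic (profile ℰ) (period ℰ) :=
  fun x => by
    rw [profile, add_mul, period_mul_sqrt h₀, jacobiSn_add_four_ellipticK (modulus_sq_lt_one h₀ h₁),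
      profile]

lemma isCnoidal_profile (h₀ : 0 < ℰ) (h₁ : ℰ < 1) :
    IsCnoidal ℰ (period ℰ) (profile ℰ) (profileDeriv ℰ) where
  pos := h₀
  lt_one := h₁
  period_pos := mul_pos (mul_pos four_pos (Real.sqrt_pos.2 (div_pos two_pos (by linarith))))
    (ellipticK_pos (modulus_sq_lt_one h₀ h₁))
  hasDerivAt := hasDerivAt_profile h₀ h₁
  hasDerivAt' := hasDerivAt_profileDeriv h₀ h₁
  first_integral := profileDeriv_sq h₀ h₁
  le x := by linarith [profile_sq_le h₁ x]
  zero := by rw [profile, zero_mul, jacobiSn_zero (modulus_sq_lt_one h₀ h₁), mul_zero]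
  periodic := profile_periodic h₀ h₁

end Profile

/-! ### Locally absolutely continuous functions -/

section LocallyIntegrable

lemma intervalIntegrable_of_locallyIntegrable {E : Type*} [NormedAddCommGroup E] {f : ℝ → E}
    (hf : LocallyIntegrable f) (a b : ℝ) : IntervalIntegrable f volume a b :=
  intervalIntegrable_iff.mpr <|
    (hf.integrableOn_isCompact isCompact_uIcc).mono_set uIoc_subset_uIcc

lemma integrable_of_locallyIntegrable_of_hasCompactSupport {E : Type*} [NormedAddCommGroup E]
    {f : ℝ → E} (hf : LocallyIntegrable f) (hc : HasCompactSupport f) : Integrable f :=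
  (integrableOn_iff_integrable_of_support_subset (subset_tsupport f)).1
    (hf.integrableOn_isCompact hc)

lemma locallyIntegrable_mul_of_sq {f g : ℝ → ℝ} (hf : LocallyIntegrable f)
    (hg : LocallyIntegrable g) (hf2 : LocallyIntegrable fun x => f x ^ 2)
    (hg2 : LocallyIntegrable fun x => g x ^ 2) : LocallyIntegrable fun x => f x * g x := by
  refine (hf2.add hg2).mono (hf.aestronglyMeasurable.mul hg.aestronglyMeasurable) <|
    Eventually.of_forall fun x => ?_
  rw [Pi.add_apply, Real.norm_eq_abs, Real.norm_eq_abs, abs_mul,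
    abs_of_nonneg (add_nonneg (sq_nonneg (f x)) (sq_nonneg (g x))), ← sq_abs (f x), ← sq_abs (g x)]
  nlinarith [two_mul_le_add_sq |f x| |g x|, mul_nonneg (abs_nonneg (f x)) (abs_nonneg (g x))]

lemma ae_eq_zero_of_frequently_integral_le {h : ℝ → ℝ} (hloc : LocallyIntegrable h)
    (h0 : ∀ x, 0 ≤ h x) (hε : ∀ ε > 0, ∃ᶠ R in atTop, ∫ x in -R..R, h x ≤ ε) : h =ᵐ[volume] 0 := by
  refine ae_eq_zero_of_forall_setIntegral_isCompact_eq_zero' hloc fun K hK => ?_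
  refine le_antisymm (le_of_forall_pos_le_add fun ε ε0 => ?_) (integral_nonneg h0)
  obtain ⟨r, hr⟩ := hK.isBounded.subset_closedBall 0
  obtain ⟨R, hR, hrR, hR0⟩ :=
    ((hε ε ε0).and_eventually ((eventually_gt_atTop r).and (eventually_ge_atTop 0))).exists
  have hKR : K ⊆ Ioc (-R) R := fun x hx => by
    have hx := abs_le.1 (mem_closedBall_zero_iff.1 (hr hx))
    exact ⟨by linarith, by linarith⟩
  rw [intervalIntegral.integral_of_le (by linarith)] at hR
  rw [zero_add]
  refine (setIntegral_mono_set ?_ (Eventually.of_forall h0) hKR.eventuallyLE).trans hR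
  exact (hloc.integrableOn_isCompact isCompact_Icc).mono_set Ioc_subset_Icc_self

end LocallyIntegrable

section IsPrim

variable {E E' : Type*} [NormedAddCommGroup E] [NormedSpace ℝ E]
  [NormedAddCommGroup E'] [NormedSpace ℝ E']

/-- `F` is locally absolutely continuous with almost everywhere derivative `f`, encoded as: `f` is
locally integrable and its integrals are the increments of `F`. -/
structure IsPrim (F f : ℝ → E) : Prop where
  loc : LocallyIntegrable f
  ftc : ∀ a b : ℝ, ∫ x in a..b, f x = F b - F a

namespace IsPrim

section Vector

variable {F f G g : ℝ → E}

lemma intervalIntegrable (h : IsPrim F f) (a b : ℝ) : IntervalIntegrable f volume a b :=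
  intervalIntegrable_of_locallyIntegrable h.loc a b

lemma eq_integral_add (h : IsPrim F f) (a : ℝ) : F = fun x => (∫ t in a..x, f t) + F a := by
  funext x
  rw [h.ftc, sub_add_cancel]

lemma continuous (h : IsPrim F f) : Continuous F := by
  rw [h.eq_integral_add 0]
  exact (intervalIntegral.continuous_primitive h.intervalIntegrable 0).add continuous_const

lemma hasDerivAt [CompleteSpace E] (h : IsPrim F f) (hf : Continuous f) (x : ℝ) :
    HasDerivAt F (f x) x := by
  rw [h.eq_integral_add 0]
  exact (hf.integral_hasStrictDerivAt 0 x).hasDerivAt.add_const _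

lemma ae_hasDerivAt [CompleteSpace E] (h : IsPrim F f) : ∀ᵐ x, HasDerivAt F (f x) x := by
  filter_upwards [LocallyIntegrable.ae_hasDerivAt_integral h.loc] with x hx
  rw [h.eq_integral_add 0]
  exact (hx 0).add_const _

lemma deriv_ae_eq [CompleteSpace E] (h : IsPrim F f) : deriv F =ᵐ[volume] f :=
  h.ae_hasDerivAt.mono fun _ hx => hx.deriv

lemma congr_ae (h : IsPrim F f) (hfg : f =ᵐ[volume] g) : IsPrim F g :=
  ⟨h.loc.congr hfg, fun a b => by
    rw [← h.ftc a b, intervalIntegral.integral_congr_ae (hfg.mono fun x hx _ => hx.symm)]⟩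

lemma of_hasDerivAt [CompleteSpace E] (h : ∀ x, HasDerivAt F (f x) x) (hf : Continuous f) :
    IsPrim F f :=
  ⟨hf.locallyIntegrable, fun a b => intervalIntegral.integral_eq_sub_of_hasDerivAt
    (fun x _ => h x) (hf.intervalIntegrable a b)⟩

lemma integral (hf : LocallyIntegrable f) : IsPrim (fun x => ∫ t in (0 : ℝ)..x, f t) f :=
  ⟨hf, fun _ _ => (intervalIntegral.integral_interval_sub_left
    (intervalIntegrable_of_locallyIntegrable hf _ _)
    (intervalIntegrable_of_locallyIntegrable hf _ _)).symm⟩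

lemma add (hF : IsPrim F f) (hG : IsPrim G g) :
    IsPrim (fun x => F x + G x) (fun x => f x + g x) :=
  ⟨hF.loc.add hG.loc, fun a b => by
    rw [intervalIntegral.integral_add (hF.intervalIntegrable a b) (hG.intervalIntegrable a b),
      hF.ftc, hG.ftc, add_sub_add_comm]⟩

lemma neg (hF : IsPrim F f) : IsPrim (fun x => -F x) (fun x => -f x) :=
  ⟨hF.loc.neg, fun a b => by rw [intervalIntegral.integral_neg, hF.ftc, neg_sub_neg, neg_sub]⟩

lemma clm_comp [CompleteSpace E] [CompleteSpace E'] (L : E →L[ℝ] E') (hF : IsPrim F f) :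
    IsPrim (fun x => L (F x)) (fun x => L (f x)) :=
  ⟨locallyIntegrableOn_univ.1 (L.locallyIntegrableOn_comp (locallyIntegrableOn_univ.2 hF.loc)),
    fun a b => by
      rw [L.intervalIntegral_comp_comm (hF.intervalIntegrable a b), hF.ftc, map_sub]⟩

lemma integral_eq_zero (hF : IsPrim F f) (hFi : Integrable F) (hfi : Integrable f) :
    ∫ x, f x = 0 := by
  have hlim : Tendsto (fun R => F R - F (-R)) atTop (nhds (∫ x, f x)) := by
    simpa only [hF.ftc, id] using
      intervalIntegral_tendsto_integral hfi tendsto_neg_atTop_atBot tendsto_id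
  refine IntegrableAtFilter.eq_zero_of_tendsto (μ := volume)
    ⟨univ, univ_mem, (hFi.sub hFi.comp_neg).integrableOn⟩ (fun s hs => ?_) hlim
  obtain ⟨a, ha⟩ := mem_atTop_sets.1 hs
  exact top_unique (Real.volume_Ici (a := a) ▸ measure_mono ha)

end Vector

section Real

variable {F f G g : ℝ → ℝ}

lemma absolutelyContinuousOnInterval (h : IsPrim F f) (a b : ℝ) :
    AbsolutelyContinuousOnInterval F a b := by
  rw [h.eq_integral_add a]
  exact ((h.intervalIntegrable a b).absolutelyContinuousOnInterval_intervalIntegral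
    left_mem_uIcc).add
      (contDiff_const (n := 1)).contDiffOn.absolutelyContinuousOnInterval

lemma mul (hF : IsPrim F f) (hG : IsPrim G g) :
    IsPrim (fun x => F x * G x) (fun x => f x * G x + F x * g x) := by
  refine ⟨(hF.loc.mul_continuous hG.continuous).add (hG.loc.continuous_mul hF.continuous),
    fun a b => ?_⟩
  rw [← (hF.absolutelyContinuousOnInterval a b).integral_deriv_mul_eq_sub
    (hG.absolutelyContinuousOnInterval a b)]
  apply intervalIntegral.integral_congr_ae
  filter_upwards [hF.deriv_ae_eq, hG.deriv_ae_eq] with x hx hx' _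
  rw [hx, hx']

lemma integral_eq_zero_of_hasCompactSupport (hF : IsPrim F f) (hFc : HasCompactSupport F)
    (hfc : HasCompactSupport f) : ∫ x, f x = 0 :=
  hF.integral_eq_zero (hF.continuous.integrable_of_hasCompactSupport hFc)
    (integrable_of_locallyIntegrable_of_hasCompactSupport hF.loc hfc)

lemma integral_mul_eq_neg (hF : IsPrim F f) (hG : IsPrim G g) (hGc : HasCompactSupport G)
    (hgc : HasCompactSupport g) : ∫ x, F x * g x = -∫ x, f x * G x := by
  have hfG : Integrable fun x => f x * G x := integrable_of_locallyIntegrable_of_hasCompactSupport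
    (hF.loc.mul_continuous hG.continuous) hGc.mul_left
  have hFg : Integrable fun x => F x * g x := integrable_of_locallyIntegrable_of_hasCompactSupport
    (hG.loc.continuous_mul hF.continuous) hgc.mul_left
  have hzero := (hF.mul hG).integral_eq_zero_of_hasCompactSupport hGc.mul_left
    (hGc.mul_left.add hgc.mul_left)
  rw [integral_add hfG hFg] at hzero
  linarith

end Real

end IsPrim

end IsPrim

section DuBoisReymond

variable {m : ℝ → ℝ}

lemma exists_contDiff_integral_eq_one :
    ∃ θ : ℝ → ℝ, ContDiff ℝ ∞ θ ∧ HasCompactSupport θ ∧ ∫ x, θ x = 1 := by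
  let b : ContDiffBump (0 : ℝ) := default
  exact ⟨b.normed volume, b.contDiff_normed, b.hasCompactSupport_normed, b.integral_normed⟩

lemma hasCompactSupport_integral_Iic {ψ : ℝ → ℝ} (hc : HasCompactSupport ψ)
    (h0 : ∫ x, ψ x = 0) : HasCompactSupport fun x => ∫ t in Iic x, ψ t := by
  obtain ⟨R, hR⟩ := hc.isCompact.isBounded.subset_closedBall 0
  have hψ : ∀ t, R < |t| → ψ t = 0 := fun t ht => image_eq_zero_of_notMem_tsupport fun hmem =>
    ht.not_ge (mem_closedBall_zero_iff.1 (hR hmem))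
  refine HasCompactSupport.intro (isCompact_Icc (a := -R) (b := R)) fun x hx => ?_
  rcases lt_or_ge x (-R) with hxR | hxR
  · exact setIntegral_eq_zero_of_forall_eq_zero fun t ht =>
      hψ t (lt_abs.2 (.inr (by linarith [mem_Iic.1 ht])))
  · have hRx : R < x := not_le.1 fun h => hx ⟨hxR, h⟩
    rw [← h0]
    exact setIntegral_eq_integral_of_forall_compl_eq_zero fun t ht =>
      hψ t ((hRx.trans (not_le.1 ht)).trans_le (le_abs_self t))

lemma exists_deriv_eq_of_integral_eq_zero {ψ : ℝ → ℝ} (h : ContDiff ℝ ∞ ψ)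
    (hc : HasCompactSupport ψ) (h0 : ∫ x, ψ x = 0) :
    ∃ φ : ℝ → ℝ, ContDiff ℝ ∞ φ ∧ HasCompactSupport φ ∧ deriv φ = ψ := by
  have hint : Integrable ψ := h.continuous.integrable_of_hasCompactSupport hc
  have hd (x : ℝ) : HasDerivAt (fun x => ∫ t in Iic x, ψ t) (ψ x) x := by
    refine ((h.continuous.integral_hasStrictDerivAt 0 x).hasDerivAt.const_add
      (∫ t in Iic 0, ψ t)).congr_of_eventuallyEq (Eventually.of_forall fun y => ?_)
    beta_reduce
    rw [← intervalIntegral.integral_Iic_sub_Iic hint.integrableOn hint.integrableOn,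
      add_sub_cancel]
  have hderiv : deriv (fun x => ∫ t in Iic x, ψ t) = ψ := funext fun x => (hd x).deriv
  refine ⟨_, ?_, hasCompactSupport_integral_Iic hc h0, hderiv⟩
  rw [contDiff_infty_iff_deriv, hderiv]
  exact ⟨fun x => (hd x).differentiableAt, h⟩

lemma exists_deriv_eq_sub_integral_mul {θ ψ : ℝ → ℝ} (hθ : ContDiff ℝ ∞ θ)
    (hθc : HasCompactSupport θ) (hθ1 : ∫ x, θ x = 1) (hψ : ContDiff ℝ ∞ ψ)
    (hψc : HasCompactSupport ψ) :
    ∃ φ : ℝ → ℝ, ContDiff ℝ ∞ φ ∧ HasCompactSupport φ ∧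
      deriv φ = fun x => ψ x - (∫ y, ψ y) * θ x := by
  refine exists_deriv_eq_of_integral_eq_zero (hψ.sub (contDiff_const.mul hθ))
    (hψc.sub hθc.mul_left) ?_
  rw [integral_sub (hψ.continuous.integrable_of_hasCompactSupport hψc)
    ((hθ.continuous.integrable_of_hasCompactSupport hθc).const_mul _), integral_const_mul, hθ1,
    mul_one, sub_self]

lemma ae_eq_const_of_integral_mul_deriv_eq_zero (hm : LocallyIntegrable m)
    (h : ∀ φ : ℝ → ℝ, ContDiff ℝ ∞ φ → HasCompactSupport φ → ∫ x, m x * deriv φ x = 0) :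
    ∃ c, ∀ᵐ x, m x = c := by
  obtain ⟨θ, hθ, hθc, hθ1⟩ := exists_contDiff_integral_eq_one
  have hmi {φ : ℝ → ℝ} (hφ : Continuous φ) (hφc : HasCompactSupport φ) :
      Integrable fun x => m x * φ x := hm.integrable_smul_right_of_hasCompactSupport hφ hφc
  set c := ∫ x, m x * θ x with hc
  refine ⟨c, ?_⟩
  have hzero : ∀ᵐ x, m x - c = 0 :=
    ae_eq_zero_of_integral_contDiff_smul_eq_zero (hm.sub (locallyIntegrable_const c))
      fun ψ hψ hψc => by
    obtain ⟨φ, hφ, hφc, hφd⟩ := exists_deriv_eq_sub_integral_mul hθ hθc hθ1 hψ hψc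
    have hmφ := h φ hφ hφc
    have hψi : Integrable ψ := hψ.continuous.integrable_of_hasCompactSupport hψc
    simp only [hφd, mul_sub, mul_left_comm (m _) (∫ y, ψ y)] at hmφ
    rw [integral_sub (hmi hψ.continuous hψc) ((hmi hθ.continuous hθc).const_mul _),
      integral_const_mul, ← hc] at hmφ
    simp only [smul_eq_mul, mul_comm (ψ _), sub_mul]
    rw [integral_sub (hmi hψ.continuous hψc) (hψi.const_mul c), integral_const_mul]
    linarith
  exact hzero.mono fun x => sub_eq_zero.1

lemma ae_eq_affine_of_integral_mul_deriv_deriv_eq_zero (hm : LocallyIntegrable m)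
    (h : ∀ φ : ℝ → ℝ, ContDiff ℝ ∞ φ → HasCompactSupport φ →
      ∫ x, m x * deriv (deriv φ) x = 0) :
    ∃ α β : ℝ, ∀ᵐ x, m x = α + β * x := by
  obtain ⟨θ, hθ, hθc, hθ1⟩ := exists_contDiff_integral_eq_one
  have hmi {φ : ℝ → ℝ} (hφ : ContDiff ℝ ∞ φ) (hφc : HasCompactSupport φ) :
      Integrable fun x => m x * deriv φ x :=
    hm.integrable_smul_right_of_hasCompactSupport
      (contDiff_infty_iff_deriv.1 hφ).2.continuous hφc.deriv
  set β := -∫ x, m x * deriv θ x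
  have hlin : IsPrim (fun x => β * x) fun _ => β :=
    .of_hasDerivAt (fun x => ((hasDerivAt_id' x).const_mul β).congr_deriv (mul_one β))
      continuous_const
  obtain ⟨α, hα⟩ := ae_eq_const_of_integral_mul_deriv_eq_zero
    (hm.sub hlin.continuous.locallyIntegrable) fun ψ hψ hψc => by
    obtain ⟨φ, hφ, hφc, hφd⟩ := exists_deriv_eq_sub_integral_mul hθ hθc hθ1 hψ hψc
    obtain ⟨hψd, hψ'⟩ := contDiff_infty_iff_deriv.1 hψ
    have hφdd : deriv (deriv φ) = fun x => deriv ψ x - (∫ y, ψ y) * deriv θ x := by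
      rw [hφd]
      exact funext fun x => ((hψd x).hasDerivAt.sub
        (((contDiff_infty_iff_deriv.1 hθ).1 x).hasDerivAt.const_mul _)).deriv
    have hmφ := h φ hφ hφc
    simp only [hφdd, mul_sub, mul_left_comm (m _) (∫ y, ψ y)] at hmφ
    rw [integral_sub (hmi hψ hψc) ((hmi hθ hθc).const_mul _), integral_const_mul] at hmφ
    have hβψ : Integrable fun x => β * x * deriv ψ x :=
      (hlin.continuous.mul hψ'.continuous).integrable_of_hasCompactSupport hψc.deriv.mul_left
    have hparts := hlin.integral_mul_eq_neg
      (.of_hasDerivAt (fun x => (hψd x).hasDerivAt) hψ'.continuous) hψc hψc.deriv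
    rw [integral_const_mul] at hparts
    simp only [Pi.sub_apply, sub_mul]
    rw [integral_sub (hmi hψ hψc) hβψ, hparts]
    linarith
  exact ⟨α, β, hα.mono fun x hx => sub_eq_iff_eq_add.1 hx⟩

end DuBoisReymond

section Periodic

variable {f : ℝ → ℝ} {T : ℝ}

lemma periodic_deriv (hf : Function.Periodic f T) : Function.Periodic (deriv f) T := fun x => by
  rw [← deriv_comp_add_const, funext hf]

lemma exists_bound_of_periodic (hT : 0 < T) (hf : Function.Periodic f T) (hc : Continuous f) :
    ∃ M, ∀ x, |f x| ≤ M :=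
  let ⟨M, hM⟩ := (hf.isBounded_of_continuous hT.ne' hc).exists_norm_le
  ⟨M, fun x => hM _ (mem_range_self x)⟩

lemma ae_eq_zero_of_periodic_of_integral_eq_zero (hT : 0 < T) (hf : Function.Periodic f T)
    (hloc : LocallyIntegrable f) (h0 : ∀ x, 0 ≤ f x) (hint : ∫ x in 0..T, f x = 0) :
    f =ᵐ[volume] 0 := by
  have hzero (n : ℕ) : ∫ x in -(n * T)..n * T, f x = 0 := by
    have hn := hf.intervalIntegral_add_zsmul_eq (2 * n : ℤ) (-(n * T))
      (fun a b => intervalIntegrable_of_locallyIntegrable hloc a b)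
    have hend : -(n * T) + (2 * n : ℤ) • T = n * T := by
      rw [zsmul_eq_mul]
      push_cast
      ring
    rw [hend, hf.intervalIntegral_add_eq (-(n * T)) 0, zero_add, hint, smul_zero] at hn
    exact hn
  refine ae_eq_zero_of_frequently_integral_le hloc h0 fun ε hε => ?_
  have hlim : Tendsto (fun n : ℕ => n * T) atTop atTop :=
    tendsto_natCast_atTop_atTop.atTop_mul_const hT
  exact hlim.frequently (Frequently.of_forall fun n => (hzero n).trans_le hε.le)

lemma memLp_periodic_mul {c u : ℝ → ℝ} (hT : 0 < T) (hc : Function.Periodic c T)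
    (hcc : Continuous c) (hu : MemLp u 2) : MemLp (fun x => c x * u x) 2 := by
  obtain ⟨M, hM⟩ := exists_bound_of_periodic hT hc hcc
  refine hu.of_le_mul (c := M) (hcc.aestronglyMeasurable.mul hu.1) <|
    Eventually.of_forall fun x => ?_
  rw [norm_mul]
  exact mul_le_mul_of_nonneg_right (hM x) (norm_nonneg _)

lemma integrable_periodic_mul_mul {c u v : ℝ → ℝ} (hT : 0 < T) (hc : Function.Periodic c T)
    (hcc : Continuous c) (hu : MemLp u 2) (hv : MemLp v 2) :
    Integrable fun x => c x * (u x * v x) := by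
  simpa only [Pi.mul_def, mul_assoc] using (memLp_periodic_mul hT hc hcc hu).integrable_mul hv

end Periodic

lemma locallyIntegrable_sq_continuous_mul_add {b c f : ℝ → ℝ} (hb : Continuous b)
    (hc : Continuous c) (hf : LocallyIntegrable f) (hf2 : LocallyIntegrable fun x => f x ^ 2) :
    LocallyIntegrable fun x => (b x * f x + c x) ^ 2 := by
  refine (((hf2.continuous_mul (hb.pow 2)).add
    (hf.continuous_mul ((continuous_const (y := 2)).mul (hb.mul hc)))).add
      (hc.pow 2).locallyIntegrable).congr (Eventually.of_forall fun x => ?_)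
  simp only [Pi.add_apply, Pi.mul_apply, Pi.pow_apply]
  ring

/-- `f ∈ H²_loc(ℝ)` for a real function `f`, represented by its `C¹` representative; the
weak second derivative is then `deriv (deriv f)`. -/
structure IsH2Loc (f : ℝ → ℝ) : Prop where
  contDiff : ContDiff ℝ 1 f
  isPrim : IsPrim (deriv f) (deriv (deriv f))
  sq : LocallyIntegrable fun x => deriv (deriv f) x ^ 2

namespace IsH2Loc

variable {f η : ℝ → ℝ}

lemma continuous (hf : IsH2Loc f) : Continuous f := hf.contDiff.continuous

lemma continuous_deriv (hf : IsH2Loc f) : Continuous (deriv f) := hf.isPrim.continuous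

lemma hasDerivAt (hf : IsH2Loc f) (x : ℝ) : HasDerivAt f (deriv f x) x :=
  (hf.contDiff.differentiable one_ne_zero x).hasDerivAt

lemma isPrim_zero (hf : IsH2Loc f) : IsPrim f (deriv f) :=
  .of_hasDerivAt hf.hasDerivAt hf.continuous_deriv

lemma of_isPrim {f₁ f₂ : ℝ → ℝ} (h : ∀ x, HasDerivAt f (f₁ x) x) (h₁ : IsPrim f₁ f₂)
    (h₂ : LocallyIntegrable fun x => f₂ x ^ 2) : IsH2Loc f := by
  have hderiv : deriv f = f₁ := funext fun x => (h x).deriv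
  have hae : f₂ =ᵐ[volume] deriv f₁ := h₁.deriv_ae_eq.symm
  refine ⟨contDiff_one_iff_deriv.2 ⟨fun x => (h x).differentiableAt, ?_⟩, ?_, ?_⟩ <;> rw [hderiv]
  · exact h₁.continuous
  · exact h₁.congr_ae hae
  · exact h₂.congr (hae.fun_comp (· ^ 2))

lemma of_contDiff (hf : ContDiff ℝ 2 f) : IsH2Loc f := by
  obtain ⟨hd, -, hf'⟩ := contDiff_succ_iff_deriv.1 (show ContDiff ℝ (1 + 1) f from hf)
  obtain ⟨hd', hc⟩ := contDiff_one_iff_deriv.1 hf'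
  exact of_isPrim (fun x => (hd x).hasDerivAt) (.of_hasDerivAt (fun x => (hd' x).hasDerivAt) hc)
    (hc.pow 2).locallyIntegrable

lemma contDiff_mul (hη : ContDiff ℝ 2 η) (hf : IsH2Loc f) : IsH2Loc fun x => η x * f x := by
  have hη' : Continuous (deriv (deriv η)) :=
    (contDiff_one_iff_deriv.1 (contDiff_succ_iff_deriv.1
      (show ContDiff ℝ (1 + 1) η from hη)).2.2).2
  have hηH := of_contDiff hη
  refine of_isPrim (fun x => (hηH.hasDerivAt x).fun_mul (hf.hasDerivAt x))
    ((hηH.isPrim.mul hf.isPrim_zero).add (hηH.isPrim_zero.mul hf.isPrim)) ?_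
  refine (locallyIntegrable_sq_continuous_mul_add (b := η)
    (c := fun x => deriv (deriv η) x * f x + 2 * (deriv η x * deriv f x)) hη.continuous
    ((hη'.mul hf.continuous).add
      (continuous_const.mul (hηH.continuous_deriv.mul hf.continuous_deriv)))
    hf.isPrim.loc hf.sq).congr (Eventually.of_forall fun x => ?_)
  simp only
  ring

end IsH2Loc

/-! ### Sums of two squares of differential operators -/

/-- The coefficients of the operators `P f = f'' + g f' + q f` and `Z f = r f' + s f`, together
with the coefficient `γ` of a boundary term. Integration by parts turns
`∫ (P f · P h + Z f · Z h)` into a form with independent coefficients of `f'' h''`, `f' h'` and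
`f h`, where `γ` is the freedom in the choice of the coefficient of `f h' + f' h`. -/
structure SquareForm where
  g : ℝ → ℝ
  q : ℝ → ℝ
  r : ℝ → ℝ
  s : ℝ → ℝ
  γ : ℝ → ℝ
  contDiff_g : ContDiff ℝ 1 g
  contDiff_q : ContDiff ℝ 1 q
  contDiff_γ : ContDiff ℝ 1 γ
  continuous_r : Continuous r
  continuous_s : Continuous s

namespace SquareForm

variable (F : SquareForm) {f k : ℝ → ℝ} {T : ℝ}

/-- The second-order operator `P f = f'' + g f' + q f`. -/
def P (f : ℝ → ℝ) (x : ℝ) : ℝ := deriv (deriv f) x + F.g x * deriv f x + F.q x * f x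

/-- The first-order operator `Z f = r f' + s f`. -/
def Z (f : ℝ → ℝ) (x : ℝ) : ℝ := F.r x * deriv f x + F.s x * f x

/-- The density `P f · P k + Z f · Z k`. -/
def sq (f k : ℝ → ℝ) (x : ℝ) : ℝ := F.P f x * F.P k x + F.Z f x * F.Z k x

/-- The coefficient of `f' k'` in `SquareForm.form`. -/
def coeffOne (x : ℝ) : ℝ := F.g x ^ 2 + F.r x ^ 2 - deriv F.g x - 2 * F.q x

/-- The coefficient of `f k' + f' k` in `SquareForm.form`. -/
def coeffMixed (x : ℝ) : ℝ := F.g x * F.q x + F.r x * F.s x + F.γ x - deriv F.q x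

/-- The coefficient of `f k` in `SquareForm.form`. -/
def coeffZero (x : ℝ) : ℝ := F.q x ^ 2 + F.s x ^ 2 + deriv F.γ x

/-- The density obtained from `SquareForm.sq` by adding the derivative of
`SquareForm.boundary`. -/
def form (f k : ℝ → ℝ) (x : ℝ) : ℝ :=
  deriv (deriv f) x * deriv (deriv k) x + F.coeffOne x * (deriv f x * deriv k x)
    + F.coeffMixed x * (f x * deriv k x + deriv f x * k x) + F.coeffZero x * (f x * k x)

/-- The boundary term of the integration by parts leading from `SquareForm.sq` to
`SquareForm.form`. -/
def boundary (f k : ℝ → ℝ) (x : ℝ) : ℝ :=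
  F.γ x * (f x * k x) - F.q x * (f x * deriv k x + deriv f x * k x)
    - F.g x * (deriv f x * deriv k x)

lemma continuous_coeffOne : Continuous F.coeffOne :=
  (((F.contDiff_g.continuous.pow 2).add (F.continuous_r.pow 2)).sub
    (F.contDiff_g.continuous_deriv le_rfl)).sub (continuous_const.mul F.contDiff_q.continuous)

lemma continuous_coeffMixed : Continuous F.coeffMixed :=
  (((F.contDiff_g.continuous.mul F.contDiff_q.continuous).add
    (F.continuous_r.mul F.continuous_s)).add F.contDiff_γ.continuous).sub
      (F.contDiff_q.continuous_deriv le_rfl)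

lemma continuous_coeffZero : Continuous F.coeffZero :=
  ((F.contDiff_q.continuous.pow 2).add (F.continuous_s.pow 2)).add
    (F.contDiff_γ.continuous_deriv le_rfl)

lemma isPrim_boundary (hf : IsH2Loc f) (hk : IsH2Loc k) :
    IsPrim (F.boundary f k) fun x => F.form f k x - F.sq f k x := by
  have hprim {c : ℝ → ℝ} (hc : ContDiff ℝ 1 c) : IsPrim c (deriv c) :=
    .of_hasDerivAt (fun x => (hc.differentiable one_ne_zero x).hasDerivAt)
      (hc.continuous_deriv le_rfl)
  have hγ := (hprim F.contDiff_γ).mul (hf.isPrim_zero.mul hk.isPrim_zero)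
  have hq := (hprim F.contDiff_q).mul
    ((hf.isPrim_zero.mul hk.isPrim).add (hf.isPrim.mul hk.isPrim_zero))
  have hg := (hprim F.contDiff_g).mul (hf.isPrim.mul hk.isPrim)
  convert (hγ.add hq.neg).add hg.neg using 1 <;> funext x
  · simp only [boundary]
    ring
  · simp only [form, sq, P, Z, coeffOne, coeffMixed, coeffZero]
    ring

lemma continuous_Z (hf : IsH2Loc f) : Continuous (F.Z f) :=
  (F.continuous_r.mul hf.continuous_deriv).add (F.continuous_s.mul hf.continuous)

lemma locallyIntegrable_P (hf : IsH2Loc f) : LocallyIntegrable (F.P f) :=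
  (hf.isPrim.loc.add
    (F.contDiff_g.continuous.mul hf.continuous_deriv).locallyIntegrable).add
      (F.contDiff_q.continuous.mul hf.continuous).locallyIntegrable

lemma locallyIntegrable_P_sq (hf : IsH2Loc f) : LocallyIntegrable fun x => F.P f x ^ 2 := by
  have hlower : Continuous fun x => F.g x * deriv f x + F.q x * f x :=
    (F.contDiff_g.continuous.mul hf.continuous_deriv).add
      (F.contDiff_q.continuous.mul hf.continuous)
  simpa only [one_mul, P, add_assoc] using locallyIntegrable_sq_continuous_mul_add
    (continuous_const (y := 1)) hlower hf.isPrim.loc hf.sq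

lemma locallyIntegrable_sq (hf : IsH2Loc f) (hk : IsH2Loc k) : LocallyIntegrable (F.sq f k) :=
  (locallyIntegrable_mul_of_sq (F.locallyIntegrable_P hf) (F.locallyIntegrable_P hk)
    (F.locallyIntegrable_P_sq hf) (F.locallyIntegrable_P_sq hk)).add
      ((F.continuous_Z hf).mul (F.continuous_Z hk)).locallyIntegrable

lemma locallyIntegrable_form (hf : IsH2Loc f) (hk : IsH2Loc k) :
    LocallyIntegrable (F.form f k) :=
  ((F.locallyIntegrable_sq hf hk).add (F.isPrim_boundary hf hk).loc).congr
    (Eventually.of_forall fun x => by simp only [Pi.add_apply, add_sub_cancel])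

lemma sq_self_nonneg (f : ℝ → ℝ) (x : ℝ) : 0 ≤ F.sq f f x :=
  add_nonneg (mul_self_nonneg _) (mul_self_nonneg _)

lemma sq_self_eq_zero_iff (f : ℝ → ℝ) (x : ℝ) : F.sq f f x = 0 ↔ F.P f x = 0 ∧ F.Z f x = 0 := by
  rw [sq, add_eq_zero_iff_of_nonneg (mul_self_nonneg _) (mul_self_nonneg _), mul_self_eq_zero,
    mul_self_eq_zero]

lemma sq_zero_right (f : ℝ → ℝ) : F.sq f (fun _ => 0) = 0 := funext fun x => by
  simp [sq, P, Z]

lemma integral_form_eq_integral_sq (hf : IsH2Loc f) (hk : IsH2Loc k)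
    (hb : Integrable (F.boundary f k)) (hform : Integrable (F.form f k))
    (hsq : Integrable (F.sq f k)) : ∫ x, F.form f k x = ∫ x, F.sq f k x := by
  rw [← sub_eq_zero, ← integral_sub hform hsq]
  exact (F.isPrim_boundary hf hk).integral_eq_zero hb (hform.sub hsq)

lemma hasCompactSupport_sq (f : ℝ → ℝ) (hkc : HasCompactSupport k) :
    HasCompactSupport (F.sq f k) := by
  have hP : HasCompactSupport (F.P k) :=
    (hkc.deriv.deriv.add hkc.deriv.mul_left).add hkc.mul_left
  have hZ : HasCompactSupport (F.Z k) := hkc.deriv.mul_left.add hkc.mul_left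
  exact hP.mul_left.add hZ.mul_left

lemma hasCompactSupport_form (f : ℝ → ℝ) (hkc : HasCompactSupport k) :
    HasCompactSupport (F.form f k) :=
  ((hkc.deriv.deriv.mul_left.add hkc.deriv.mul_left.mul_left).add
    (hkc.deriv.mul_left.add hkc.mul_left).mul_left).add hkc.mul_left.mul_left

lemma integral_form_eq_integral_sq_of_hasCompactSupport (hf : IsH2Loc f) (hk : IsH2Loc k)
    (hkc : HasCompactSupport k) : ∫ x, F.form f k x = ∫ x, F.sq f k x := by
  have hb : HasCompactSupport (F.boundary f k) :=
    (hkc.mul_left.mul_left.sub (hkc.deriv.mul_left.add hkc.mul_left).mul_left).sub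
      hkc.deriv.mul_left.mul_left
  exact F.integral_form_eq_integral_sq hf hk
    ((F.isPrim_boundary hf hk).continuous.integrable_of_hasCompactSupport hb)
    (integrable_of_locallyIntegrable_of_hasCompactSupport (F.locallyIntegrable_form hf hk)
      (F.hasCompactSupport_form f hkc))
    (integrable_of_locallyIntegrable_of_hasCompactSupport (F.locallyIntegrable_sq hf hk)
      (F.hasCompactSupport_sq f hkc))

/-- All coefficients of `F` have the period `T > 0`. -/
structure IsPeriodic (F : SquareForm) (T : ℝ) : Prop where
  pos : 0 < T
  g : Function.Periodic F.g T
  q : Function.Periodic F.q T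
  r : Function.Periodic F.r T
  s : Function.Periodic F.s T
  γ : Function.Periodic F.γ T

namespace IsPeriodic

variable {F}

lemma nat_mul (hF : F.IsPeriodic T) {N : ℕ} (hN : 1 ≤ N) : F.IsPeriodic (N * T) where
  pos := mul_pos (Nat.cast_pos.2 hN) hF.pos
  g := hF.g.nat_mul N
  q := hF.q.nat_mul N
  r := hF.r.nat_mul N
  s := hF.s.nat_mul N
  γ := hF.γ.nat_mul N

lemma coeffOne (hF : F.IsPeriodic T) : Function.Periodic F.coeffOne T := fun x => by
  simp only [SquareForm.coeffOne, hF.g x, hF.q x, hF.r x, periodic_deriv hF.g x]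

lemma coeffMixed (hF : F.IsPeriodic T) : Function.Periodic F.coeffMixed T := fun x => by
  simp only [SquareForm.coeffMixed, hF.g x, hF.q x, hF.r x, hF.s x, hF.γ x,
    periodic_deriv hF.q x]

lemma coeffZero (hF : F.IsPeriodic T) : Function.Periodic F.coeffZero T := fun x => by
  simp only [SquareForm.coeffZero, hF.q x, hF.s x, periodic_deriv hF.γ x]

lemma integral_form_eq_integral_sq (hF : F.IsPeriodic T) (hf : IsH2Loc f) (hk : IsH2Loc k)
    (hfT : Function.Periodic f T) (hkT : Function.Periodic k T) :
    ∫ x in 0..T, F.form f k x = ∫ x in 0..T, F.sq f k x := by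
  have hb : F.boundary f k T = F.boundary f k 0 := by
    simp only [boundary, hfT.eq, hkT.eq, (periodic_deriv hfT).eq, (periodic_deriv hkT).eq,
      hF.g.eq, hF.q.eq, hF.γ.eq]
  rw [← sub_eq_zero, ← intervalIntegral.integral_sub
    (intervalIntegrable_of_locallyIntegrable (F.locallyIntegrable_form hf hk) 0 T)
    (intervalIntegrable_of_locallyIntegrable (F.locallyIntegrable_sq hf hk) 0 T),
    (F.isPrim_boundary hf hk).ftc, hb, sub_self]

lemma integral_sq_eq_zero_iff (hF : F.IsPeriodic T) (hf : IsH2Loc f)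
    (hfT : Function.Periodic f T) : ∫ x in 0..T, F.sq f f x = 0 ↔ F.sq f f =ᵐ[volume] 0 := by
  constructor
  · refine ae_eq_zero_of_periodic_of_integral_eq_zero hF.pos (fun x => ?_)
      (F.locallyIntegrable_sq hf hf) (F.sq_self_nonneg f)
    simp only [sq, P, Z, hfT x, periodic_deriv hfT x, periodic_deriv (periodic_deriv hfT) x,
      hF.g x, hF.q x, hF.r x, hF.s x]
  · intro h
    rw [intervalIntegral.integral_zero_ae (h.mono fun x hx _ => hx)]

lemma integrable_sq (hF : F.IsPeriodic T) (h0 : MemLp f 2) (h1 : MemLp (deriv f) 2)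
    (h2 : MemLp (deriv (deriv f)) 2) : Integrable (F.sq f f) := by
  have hP : MemLp (F.P f) 2 :=
    (h2.add (memLp_periodic_mul hF.pos hF.g F.contDiff_g.continuous h1)).add
      (memLp_periodic_mul hF.pos hF.q F.contDiff_q.continuous h0)
  have hZ : MemLp (F.Z f) 2 := (memLp_periodic_mul hF.pos hF.r F.continuous_r h1).add
    (memLp_periodic_mul hF.pos hF.s F.continuous_s h0)
  exact (hP.integrable_mul hP).add (hZ.integrable_mul hZ)

lemma integrable_boundary (hF : F.IsPeriodic T) (h0 : MemLp f 2) (h1 : MemLp (deriv f) 2) :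
    Integrable (F.boundary f f) := by
  have hγ := integrable_periodic_mul_mul hF.pos hF.γ F.contDiff_γ.continuous h0 h0
  have hq {u v : ℝ → ℝ} (hu : MemLp u 2) (hv : MemLp v 2) :
      Integrable fun x => F.q x * (u x * v x) :=
    integrable_periodic_mul_mul hF.pos hF.q F.contDiff_q.continuous hu hv
  have hg := integrable_periodic_mul_mul hF.pos hF.g F.contDiff_g.continuous h1 h1
  have hsum := (hγ.sub ((hq h0 h1).add (hq h1 h0))).sub hg
  refine hsum.congr (Eventually.of_forall fun x => ?_)
  simp only [boundary, Pi.add_apply, Pi.sub_apply, mul_add]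

lemma integrable_form (hF : F.IsPeriodic T) (h0 : MemLp f 2) (h1 : MemLp (deriv f) 2)
    (h2 : MemLp (deriv (deriv f)) 2) : Integrable (F.form f f) := by
  have hone := integrable_periodic_mul_mul hF.pos hF.coeffOne F.continuous_coeffOne h1 h1
  have hmixed {u v : ℝ → ℝ} (hu : MemLp u 2) (hv : MemLp v 2) :
      Integrable fun x => F.coeffMixed x * (u x * v x) :=
    integrable_periodic_mul_mul hF.pos hF.coeffMixed F.continuous_coeffMixed hu hv
  have hzero := integrable_periodic_mul_mul hF.pos hF.coeffZero F.continuous_coeffZero h0 h0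
  have hsum := (((h2.integrable_mul h2).add hone).add ((hmixed h0 h1).add (hmixed h1 h0))).add hzero
  refine hsum.congr (Eventually.of_forall fun x => ?_)
  simp only [form, Pi.add_apply, Pi.mul_apply, mul_add]

end IsPeriodic

end SquareForm

namespace SquareForm

variable (F : SquareForm) {f k : ℝ → ℝ}

/-- The coefficient of `k'` in the density `P f · P k + Z f · Z k`. -/
def adjointOne (f : ℝ → ℝ) (x : ℝ) : ℝ := F.g x * F.P f x + F.r x * F.Z f x

/-- The coefficient of `k` in the density `P f · P k + Z f · Z k`. -/
def adjointZero (f : ℝ → ℝ) (x : ℝ) : ℝ := F.q x * F.P f x + F.s x * F.Z f x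

/-- A function whose second distributional derivative is `P* P f + Z* Z f`. -/
def moment (f : ℝ → ℝ) (x : ℝ) : ℝ :=
  F.P f x + ((∫ t in (0 : ℝ)..x, ∫ y in (0 : ℝ)..t, F.adjointZero f y)
    - ∫ t in (0 : ℝ)..x, F.adjointOne f t)

/-- `P* P f + Z* Z f = 0` in the sense of distributions. -/
def IsWeakSolution (F : SquareForm) (f : ℝ → ℝ) : Prop :=
  ∀ φ : ℝ → ℝ, ContDiff ℝ ∞ φ → HasCompactSupport φ → ∫ x, F.sq f φ x = 0

lemma isPrim_integral_adjointOne (hf : IsH2Loc f) :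
    IsPrim (fun x => ∫ t in (0 : ℝ)..x, F.adjointOne f t) (F.adjointOne f) :=
  .integral <| ((F.locallyIntegrable_P hf).continuous_mul F.contDiff_g.continuous).add
    (F.continuous_r.mul (F.continuous_Z hf)).locallyIntegrable

lemma isPrim_integral_adjointZero (hf : IsH2Loc f) :
    IsPrim (fun x => ∫ t in (0 : ℝ)..x, F.adjointZero f t) (F.adjointZero f) :=
  .integral <| ((F.locallyIntegrable_P hf).continuous_mul F.contDiff_q.continuous).add
    (F.continuous_s.mul (F.continuous_Z hf)).locallyIntegrable

lemma isPrim_integral_integral_adjointZero (hf : IsH2Loc f) :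
    IsPrim (fun x => ∫ t in (0 : ℝ)..x, ∫ y in (0 : ℝ)..t, F.adjointZero f y)
      fun x => ∫ t in (0 : ℝ)..x, F.adjointZero f t :=
  .integral (F.isPrim_integral_adjointZero hf).continuous.locallyIntegrable

lemma locallyIntegrable_moment (hf : IsH2Loc f) : LocallyIntegrable (F.moment f) :=
  (F.locallyIntegrable_P hf).add ((F.isPrim_integral_integral_adjointZero hf).continuous.sub
    (F.isPrim_integral_adjointOne hf).continuous).locallyIntegrable

lemma exists_isPrim_sq_sub_moment_mul (hf : IsH2Loc f) (hk : IsH2Loc k)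
    (hkc : HasCompactSupport k) : ∃ B : ℝ → ℝ, HasCompactSupport B ∧
      IsPrim B fun x => F.sq f k x - F.moment f x * deriv (deriv k) x := by
  have hB := (((F.isPrim_integral_adjointOne hf).mul hk.isPrim).add
    ((F.isPrim_integral_adjointZero hf).mul hk.isPrim_zero)).add
      ((F.isPrim_integral_integral_adjointZero hf).mul hk.isPrim).neg
  refine ⟨_, ?_, hB.congr_ae (Eventually.of_forall fun x => ?_)⟩
  · exact (hkc.deriv.mul_left.add hkc.mul_left).add hkc.deriv.mul_left.neg
  · simp only [sq, P, Z, moment, adjointOne, adjointZero]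
    ring

lemma integral_sq_eq_integral_moment_mul (hf : IsH2Loc f) (hk : IsH2Loc k)
    (hkc : HasCompactSupport k) :
    ∫ x, F.sq f k x = ∫ x, F.moment f x * deriv (deriv k) x := by
  obtain ⟨B, hBc, hB⟩ := F.exists_isPrim_sq_sub_moment_mul hf hk hkc
  have hsqc : HasCompactSupport (F.sq f k) := F.hasCompactSupport_sq f hkc
  have hmc : HasCompactSupport fun x => F.moment f x * deriv (deriv k) x :=
    hkc.deriv.deriv.mul_left
  have hm : LocallyIntegrable fun x => F.moment f x * deriv (deriv k) x :=
    ((F.locallyIntegrable_sq hf hk).sub hB.loc).congr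
      (Eventually.of_forall fun x => by simp only [Pi.sub_apply, sub_sub_cancel])
  rw [← sub_eq_zero, ← integral_sub
    (integrable_of_locallyIntegrable_of_hasCompactSupport (F.locallyIntegrable_sq hf hk) hsqc)
    (integrable_of_locallyIntegrable_of_hasCompactSupport hm hmc)]
  exact hB.integral_eq_zero_of_hasCompactSupport hBc (hsqc.sub hmc)

lemma integral_affine_mul_deriv_deriv (hk : IsH2Loc k) (hkc : HasCompactSupport k) (α β : ℝ) :
    ∫ x, (α + β * x) * deriv (deriv k) x = 0 := by
  have haff : IsPrim (fun x => α + β * x) fun _ => β :=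
    .of_hasDerivAt (fun x => (((hasDerivAt_id' x).const_mul β).const_add α).congr_deriv
      (mul_one β)) continuous_const
  rw [haff.integral_mul_eq_neg hk.isPrim hkc.deriv hkc.deriv.deriv, integral_const_mul,
    hk.isPrim_zero.integral_eq_zero_of_hasCompactSupport hkc hkc.deriv, mul_zero, neg_zero]

variable {F} in
lemma IsWeakSolution.integral_sq_eq_zero (hw : F.IsWeakSolution f) (hf : IsH2Loc f)
    (hk : IsH2Loc k) (hkc : HasCompactSupport k) : ∫ x, F.sq f k x = 0 := by
  obtain ⟨α, β, hm⟩ := ae_eq_affine_of_integral_mul_deriv_deriv_eq_zero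
    (F.locallyIntegrable_moment hf) fun φ hφ hφc => by
      rw [← F.integral_sq_eq_integral_moment_mul hf
        (.of_contDiff (contDiff_infty.1 hφ 2)) hφc, hw φ hφ hφc]
  rw [F.integral_sq_eq_integral_moment_mul hf hk hkc,
    ← integral_affine_mul_deriv_deriv hk hkc α β]
  exact integral_congr_ae (hm.mono fun x hx => by simp only [hx])

end SquareForm

/-! ### Bounded weak solutions -/

section PointwiseEstimates

variable {p z y y₁ h h₁ h₂ g q r w δ M C W : ℝ}

lemma abs_cutoff_coeff_le (h0 : 0 ≤ h) (h1 : h ≤ 1) (hδ : δ ≤ 1) (hh₁ : |h₁| ≤ δ)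
    (hh₂ : |h₂| ≤ δ) (hg : |g| ≤ M) :
    |12 * h₁ ^ 2 + 4 * h * h₂ + 4 * g * h * h₁| ≤ (16 + 4 * M) * δ := by
  have hδ0 : 0 ≤ δ := (abs_nonneg h₁).trans hh₁
  have hsq : |12 * h₁ ^ 2| ≤ 12 * δ := by
    rw [abs_mul, abs_pow, abs_of_nonneg (by norm_num)]
    nlinarith [abs_nonneg h₁]
  have hsecond : |4 * h * h₂| ≤ 4 * δ := by
    rw [abs_mul, abs_of_nonneg (by positivity)]
    nlinarith [abs_nonneg h₂]
  have hfirst : |4 * g * h * h₁| ≤ 4 * M * δ := by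
    rw [abs_mul, abs_mul, abs_mul, abs_of_nonneg h0, abs_of_nonneg (by norm_num : (0 : ℝ) ≤ 4)]
    have hgh : |g| * h ≤ M * 1 := mul_le_mul hg h1 h0 ((abs_nonneg g).trans hg)
    nlinarith [abs_nonneg h₁, mul_nonneg (abs_nonneg g) h0]
  linarith [abs_add_three (12 * h₁ ^ 2) (4 * h * h₂) (4 * g * h * h₁)]

lemma cutoff_sq_lower_bound (h0 : 0 ≤ h) (h1 : h ≤ 1) (hh₁ : |h₁| ≤ δ) (hr : |r| ≤ M)
    (hy : |y| ≤ C) (hw : |w| ≤ W) :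
    1 / 2 * (h ^ 4 * (p ^ 2 + z ^ 2)) - 64 * δ ^ 2 * (h ^ 2 * y₁ ^ 2)
        - (2 * W ^ 2 + 8 * M ^ 2 * δ ^ 2) * C ^ 2 ≤
      h ^ 4 * (p ^ 2 + z ^ 2) + 8 * h ^ 3 * h₁ * y₁ * p + h ^ 2 * w * y * p
        + 4 * r * h ^ 3 * h₁ * y * z := by
  have hh₁s : h₁ ^ 2 ≤ δ ^ 2 := sq_le_sq.2 (hh₁.trans (le_abs_self δ))
  have hys : y ^ 2 ≤ C ^ 2 := sq_le_sq.2 (hy.trans (le_abs_self C))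
  have hws : w ^ 2 ≤ W ^ 2 := sq_le_sq.2 (hw.trans (le_abs_self W))
  have hrs : r ^ 2 ≤ M ^ 2 := sq_le_sq.2 (hr.trans (le_abs_self M))
  have hfirst : -(1 / 4 * (h ^ 4 * p ^ 2) + 64 * δ ^ 2 * (h ^ 2 * y₁ ^ 2)) ≤
      8 * h ^ 3 * h₁ * y₁ * p := by
    have : h₁ ^ 2 * (h ^ 2 * y₁ ^ 2) ≤ δ ^ 2 * (h ^ 2 * y₁ ^ 2) := by gcongr
    linarith [sq_nonneg (1 / 2 * (h ^ 2 * p) + 8 * (h * h₁ * y₁))]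
  have hzeroth : -(1 / 8 * (h ^ 4 * p ^ 2) + 2 * (W ^ 2 * C ^ 2)) ≤ h ^ 2 * w * y * p := by
    have : w ^ 2 * y ^ 2 ≤ W ^ 2 * C ^ 2 := by gcongr
    linarith [sq_nonneg (h ^ 2 * p + 4 * (w * y))]
  have hmixed : -(1 / 2 * (h ^ 4 * z ^ 2) + 8 * (M ^ 2 * δ ^ 2 * C ^ 2)) ≤
      4 * r * h ^ 3 * h₁ * y * z := by
    have : r ^ 2 * h₁ ^ 2 * y ^ 2 * h ^ 2 ≤ M ^ 2 * δ ^ 2 * C ^ 2 * 1 := by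
      gcongr
      exact pow_le_one₀ h0 h1
    linarith [sq_nonneg (h ^ 2 * z + 4 * (r * h * h₁ * y))]
  have : 0 ≤ h ^ 4 * p ^ 2 := by positivity
  linarith

lemma caccioppoli_lower_bound (h0 : 0 ≤ h) (h1 : h ≤ 1) (hh₁ : |h₁| ≤ 1) (hg : |g| ≤ M)
    (hq : |q| ≤ M) (hy : |y| ≤ C) :
    1 / 2 * (h ^ 2 * y₁ ^ 2) - 1 / 2 * (h ^ 4 * p ^ 2) - (5 + M ^ 2 + M) * C ^ 2 ≤
      2 * h * h₁ * y * y₁ + h ^ 2 * y₁ ^ 2 + h ^ 2 * y * (p - g * y₁ - q * y) := by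
  have hM : 0 ≤ M := (abs_nonneg g).trans hg
  have hhs : h ^ 2 ≤ 1 := pow_le_one₀ h0 h1
  have hh₁s : h₁ ^ 2 ≤ 1 := (sq_le_one_iff_abs_le_one h₁).2 hh₁
  have hys : y ^ 2 ≤ C ^ 2 := sq_le_sq.2 (hy.trans (le_abs_self C))
  have hgs : g ^ 2 ≤ M ^ 2 := sq_le_sq.2 (hg.trans (le_abs_self M))
  have hcut : -(1 / 4 * (h ^ 2 * y₁ ^ 2) + 4 * C ^ 2) ≤ 2 * h * h₁ * y * y₁ := by
    have : h₁ ^ 2 * y ^ 2 ≤ 1 * C ^ 2 := by gcongr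
    linarith [sq_nonneg (1 / 2 * (h * y₁) + 2 * (h₁ * y))]
  have hsecond : -(1 / 2 * (h ^ 4 * p ^ 2) + 1 / 2 * C ^ 2) ≤ h ^ 2 * y * p := by
    linarith [sq_nonneg (h ^ 2 * p + y)]
  have hfirst : -(1 / 4 * (h ^ 2 * y₁ ^ 2) + M ^ 2 * C ^ 2) ≤ -(h ^ 2 * y * g * y₁) := by
    have : g ^ 2 * y ^ 2 * h ^ 2 ≤ M ^ 2 * C ^ 2 * 1 := by gcongr
    linarith [sq_nonneg (1 / 2 * (h * y₁) - g * y * h)]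
  have hzeroth : h ^ 2 * y ^ 2 * q ≤ 1 * C ^ 2 * M := calc
    h ^ 2 * y ^ 2 * q ≤ h ^ 2 * y ^ 2 * M := by
      gcongr
      exact (le_abs_self q).trans hq
    _ ≤ 1 * C ^ 2 * M := by gcongr
  linarith [sq_nonneg C]

/-- The error constant of the cutoff estimate, in terms of a bound `M` for the coefficients and a
bound `C` for the solution. -/
def cutoffConst (M C : ℝ) : ℝ := (2 * (16 + 4 * M) ^ 2 + 8 * M ^ 2 + 128 * (5 + M ^ 2 + M)) * C ^ 2

lemma cutoff_sq_add_caccioppoli_lower_bound (h0 : 0 ≤ h) (h1 : h ≤ 1) (hδ : δ ≤ 1 / 16)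
    (hh₁ : |h₁| ≤ δ) (hh₂ : |h₂| ≤ δ) (hg : |g| ≤ M) (hq : |q| ≤ M) (hr : |r| ≤ M)
    (hy : |y| ≤ C) :
    1 / 4 * (h ^ 4 * (p ^ 2 + z ^ 2)) - cutoffConst M C * δ ^ 2 ≤
      (h ^ 4 * (p ^ 2 + z ^ 2) + 8 * h ^ 3 * h₁ * y₁ * p
        + h ^ 2 * (12 * h₁ ^ 2 + 4 * h * h₂ + 4 * g * h * h₁) * y * p
        + 4 * r * h ^ 3 * h₁ * y * z)
      + 128 * δ ^ 2 *
        (2 * h * h₁ * y * y₁ + h ^ 2 * y₁ ^ 2 + h ^ 2 * y * (p - g * y₁ - q * y)) := by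
  have hδ0 : 0 ≤ δ := (abs_nonneg h₁).trans hh₁
  have hsq := cutoff_sq_lower_bound (p := p) (z := z) (y₁ := y₁) h0 h1 hh₁ hr hy
    (abs_cutoff_coeff_le h0 h1 (by linarith) hh₁ hh₂ hg)
  have hcac := mul_le_mul_of_nonneg_left (caccioppoli_lower_bound (p := p) (y₁ := y₁) h0 h1
    (hh₁.trans (by linarith)) hg hq hy) (by positivity : 0 ≤ 128 * δ ^ 2)
  have hδs : δ ^ 2 * (h ^ 4 * p ^ 2) ≤ (1 / 16) ^ 2 * (h ^ 4 * p ^ 2) := by gcongr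
  have hz : 0 ≤ h ^ 4 * z ^ 2 := by positivity
  rw [cutoffConst]
  linarith

end PointwiseEstimates

/-- `η` is a cutoff function for `[-R, R]` in `[-2R, 2R]` with derivatives bounded by `δ`. -/
structure IsCutoff (η : ℝ → ℝ) (R δ : ℝ) : Prop where
  contDiff : ContDiff ℝ 2 η
  nonneg (x : ℝ) : 0 ≤ η x
  le_one (x : ℝ) : η x ≤ 1
  eq_one (x : ℝ) : |x| ≤ R → η x = 1
  eq_zero (x : ℝ) : 2 * R ≤ |x| → η x = 0
  abs_deriv_le (x : ℝ) : |deriv η x| ≤ δ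
  abs_deriv_deriv_le (x : ℝ) : |deriv (deriv η) x| ≤ δ

lemma exists_forall_isCutoff : ∃ c : ℝ, ∀ R : ℝ, 1 ≤ R → ∃ η, IsCutoff η R (c / R) := by
  let b : ContDiffBump (0 : ℝ) := ⟨1, 2, by norm_num, by norm_num⟩
  have hb : ContDiff ℝ ∞ (b : ℝ → ℝ) := b.contDiff
  have hb₁ : ContDiff ℝ ∞ (deriv b) := (contDiff_infty_iff_deriv.1 hb).2
  have hb₂ : Continuous (deriv (deriv b)) := (contDiff_infty_iff_deriv.1 hb₁).2.continuous
  obtain ⟨c₁, hc₁⟩ :=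
    hb₁.continuous.bounded_above_of_compact_support b.hasCompactSupport.deriv
  obtain ⟨c₂, hc₂⟩ := hb₂.bounded_above_of_compact_support b.hasCompactSupport.deriv.deriv
  refine ⟨max c₁ c₂, fun R hR => ⟨fun x => b (R⁻¹ * x), ?_⟩⟩
  have hR0 : 0 < R := one_pos.trans_le hR
  have hd₁ : deriv (fun x => b (R⁻¹ * x)) = fun x => R⁻¹ * deriv b (R⁻¹ * x) :=
    funext fun x => deriv_comp_mul_left R⁻¹ b x
  have hd₂ : deriv (fun x => R⁻¹ * deriv b (R⁻¹ * x)) =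
      fun x => R⁻¹ * (R⁻¹ * deriv (deriv b) (R⁻¹ * x)) := funext fun x => by
    rw [deriv_const_mul_field, deriv_comp_mul_left, smul_eq_mul]
  have hscale (x : ℝ) : dist (R⁻¹ * x) 0 = |x| / R := by
    rw [dist_zero_right, norm_mul, norm_inv, Real.norm_of_nonneg hR0.le, Real.norm_eq_abs,
      inv_mul_eq_div]
  refine ⟨(contDiff_infty.1 hb 2).comp (contDiff_const.mul contDiff_id), fun _ => b.nonneg,
    fun _ => b.le_one, fun x hx => b.one_of_mem_closedBall ?_, fun x hx => b.zero_of_le_dist ?_,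
    fun x => ?_, fun x => ?_⟩
  · rw [Metric.mem_closedBall, hscale]
    exact (div_le_one hR0).2 hx
  · rw [hscale]
    exact (le_div_iff₀ hR0).2 hx
  · rw [hd₁, abs_mul, abs_of_pos (inv_pos.2 hR0), inv_mul_eq_div]
    gcongr
    exact (hc₁ _).trans (le_max_left c₁ c₂)
  · rw [hd₁, hd₂, abs_mul, abs_mul, abs_of_pos (inv_pos.2 hR0), inv_mul_eq_div]
    gcongr
    exact (mul_le_of_le_one_left (abs_nonneg _) (inv_le_one_of_one_le₀ hR)).trans
      ((hc₂ _).trans (le_max_right c₁ c₂))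

namespace SquareForm

variable {F : SquareForm} {f η : ℝ → ℝ} {M C R δ : ℝ}

/-- The coefficients `g`, `q` and `r` of `F` are bounded by `M`. -/
structure IsBounded (F : SquareForm) (M : ℝ) : Prop where
  abs_g_le (x : ℝ) : |F.g x| ≤ M
  abs_q_le (x : ℝ) : |F.q x| ≤ M
  abs_r_le (x : ℝ) : |F.r x| ≤ M

lemma IsPeriodic.exists_isBounded {T : ℝ} (hF : F.IsPeriodic T) : ∃ M, F.IsBounded M := by
  obtain ⟨Mg, hg⟩ := exists_bound_of_periodic hF.pos hF.g F.contDiff_g.continuous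
  obtain ⟨Mq, hq⟩ := exists_bound_of_periodic hF.pos hF.q F.contDiff_q.continuous
  obtain ⟨Mr, hr⟩ := exists_bound_of_periodic hF.pos hF.r F.continuous_r
  exact ⟨max Mg (max Mq Mr), fun x => (hg x).trans (le_max_left _ _),
    fun x => (hq x).trans ((le_max_left _ _).trans (le_max_right _ _)),
    fun x => (hr x).trans ((le_max_right _ _).trans (le_max_right _ _))⟩

/-- The derivative of `η² f f'`; its vanishing integral controls `η² f'²`, as in Caccioppoli's
inequality. -/
def caccioppoli (η f : ℝ → ℝ) (x : ℝ) : ℝ :=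
  2 * η x * deriv η x * f x * deriv f x + η x ^ 2 * deriv f x ^ 2
    + η x ^ 2 * f x * deriv (deriv f) x

lemma isPrim_caccioppoli (hη : IsH2Loc η) (hf : IsH2Loc f) :
    IsPrim (fun x => η x * η x * (f x * deriv f x)) (caccioppoli η f) :=
  ((hη.isPrim_zero.mul hη.isPrim_zero).mul (hf.isPrim_zero.mul hf.isPrim)).congr_ae
    (Eventually.of_forall fun x => by
      simp only [caccioppoli]
      ring)

lemma hasCompactSupport_caccioppoli (hη : HasCompactSupport η) (f : ℝ → ℝ) :
    HasCompactSupport (caccioppoli η f) := by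
  refine hη.mono fun x hx hη0 => hx ?_
  simp only [caccioppoli, hη0]
  ring

lemma ae_sq_pow_four_mul_eq (F : SquareForm) (hη : IsH2Loc η) (hf : IsH2Loc f) :
    ∀ᵐ x, F.sq f (fun x => η x ^ 4 * f x) x =
      η x ^ 4 * (F.P f x ^ 2 + F.Z f x ^ 2) + 8 * η x ^ 3 * deriv η x * deriv f x * F.P f x
        + η x ^ 2 * (12 * deriv η x ^ 2 + 4 * η x * deriv (deriv η) x
          + 4 * F.g x * η x * deriv η x) * f x * F.P f x
        + 4 * F.r x * η x ^ 3 * deriv η x * f x * F.Z f x := by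
  have hd₁ : deriv (fun x => η x ^ 4 * f x) =
      fun x => 4 * η x ^ 3 * deriv η x * f x + η x ^ 4 * deriv f x := funext fun x =>
    (((hη.hasDerivAt x).fun_pow 4).fun_mul (hf.hasDerivAt x)).deriv
  filter_upwards [hη.isPrim.ae_hasDerivAt, hf.isPrim.ae_hasDerivAt] with x hηx hfx
  have hd₂ := (((((hη.hasDerivAt x).fun_pow 3).const_mul 4).fun_mul hηx).fun_mul
    (hf.hasDerivAt x)).fun_add (((hη.hasDerivAt x).fun_pow 4).fun_mul hfx)
  simp only [sq, P, Z, hd₁, hd₂.deriv]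
  push_cast
  ring

lemma ae_cutoff_inequality (hF : F.IsBounded M) (hη : IsCutoff η R δ) (hf : IsH2Loc f)
    (hδ : δ ≤ 1 / 16) (hC : ∀ x, |f x| ≤ C) :
    ∀ᵐ x, 1 / 4 * (η x ^ 4 * F.sq f f x) ≤
      F.sq f (fun x => η x ^ 4 * f x) x + 128 * δ ^ 2 * caccioppoli η f x
        + (Icc (-(2 * R)) (2 * R)).indicator (fun _ => cutoffConst M C * δ ^ 2) x := by
  filter_upwards [F.ae_sq_pow_four_mul_eq (.of_contDiff hη.contDiff) hf] with x hx
  have hself : F.sq f f x = F.P f x ^ 2 + F.Z f x ^ 2 := by rw [sq, pow_two, pow_two]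
  rw [hx, hself]
  by_cases hxR : x ∈ Icc (-(2 * R)) (2 * R)
  · have hf₂ : deriv (deriv f) x = F.P f x - F.g x * deriv f x - F.q x * f x := by
      simp only [P]
      ring
    rw [indicator_of_mem hxR, caccioppoli, hf₂]
    linarith [cutoff_sq_add_caccioppoli_lower_bound (p := F.P f x) (z := F.Z f x)
      (y₁ := deriv f x) (hη.nonneg x) (hη.le_one x) hδ (hη.abs_deriv_le x)
      (hη.abs_deriv_deriv_le x) (hF.abs_g_le x) (hF.abs_q_le x) (hF.abs_r_le x) (hC x)]
  · have hη0 : η x = 0 := hη.eq_zero x <| not_lt.1 fun h => hxR (abs_le.1 h.le)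
    rw [indicator_of_notMem hxR, caccioppoli, hη0]
    exact le_of_eq (by ring)

end SquareForm

namespace IsCutoff

variable {f η : ℝ → ℝ} {R δ : ℝ}

lemma hasCompactSupport (hη : IsCutoff η R δ) : HasCompactSupport η :=
  .intro (isCompact_Icc (a := -(2 * R)) (b := 2 * R)) fun x hx =>
    hη.eq_zero x <| not_lt.1 fun h => hx (abs_le.1 h.le)

lemma hasCompactSupport_pow_four (hη : IsCutoff η R δ) : HasCompactSupport fun x => η x ^ 4 :=
  hη.hasCompactSupport.comp_left (g := fun t => t ^ 4) (zero_pow four_ne_zero)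

lemma integrable_pow_four_mul_sq (hη : IsCutoff η R δ) (F : SquareForm) (hf : IsH2Loc f) :
    Integrable fun x => η x ^ 4 * F.sq f f x :=
  integrable_of_locallyIntegrable_of_hasCompactSupport
    ((F.locallyIntegrable_sq hf hf).continuous_mul (hη.contDiff.continuous.pow 4))
    hη.hasCompactSupport_pow_four.mul_right

end IsCutoff

namespace SquareForm

variable {F : SquareForm} {f η : ℝ → ℝ} {M C R δ : ℝ}

lemma IsWeakSolution.integral_pow_four_mul_sq_le (hw : F.IsWeakSolution f) (hF : F.IsBounded M)
    (hη : IsCutoff η R δ) (hR : 0 ≤ R) (hf : IsH2Loc f) (hδ : δ ≤ 1 / 16)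
    (hC : ∀ x, |f x| ≤ C) :
    ∫ x, η x ^ 4 * F.sq f f x ≤ 16 * R * (cutoffConst M C * δ ^ 2) := by
  set k : ℝ → ℝ := fun x => η x ^ 4 * f x
  have hηH : IsH2Loc η := .of_contDiff hη.contDiff
  have hkH : IsH2Loc k := hf.contDiff_mul (hη.contDiff.pow 4)
  have hkc : HasCompactSupport k := hη.hasCompactSupport_pow_four.mul_right
  have hsqint : Integrable (F.sq f k) := integrable_of_locallyIntegrable_of_hasCompactSupport
    (F.locallyIntegrable_sq hf hkH) (F.hasCompactSupport_sq f hkc)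
  have hcac : IsPrim _ (caccioppoli η f) := isPrim_caccioppoli hηH hf
  have hcacc := hasCompactSupport_caccioppoli hη.hasCompactSupport f
  have hcacint := integrable_of_locallyIntegrable_of_hasCompactSupport hcac.loc hcacc
  have hconst : Integrable ((Icc (-(2 * R)) (2 * R)).indicator
      fun _ : ℝ => cutoffConst M C * δ ^ 2) :=
    (integrable_indicator_iff measurableSet_Icc).2 (integrableOn_const measure_Icc_lt_top.ne)
  have hle := integral_mono_ae ((hη.integrable_pow_four_mul_sq F hf).const_mul (1 / 4))
    ((hsqint.add (hcacint.const_mul (128 * δ ^ 2))).add hconst)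
    (ae_cutoff_inequality hF hη hf hδ hC)
  have hcac0 := hcac.integral_eq_zero_of_hasCompactSupport
    (hη.hasCompactSupport.mul_right.mul_right) hcacc
  rw [integral_const_mul, integral_add' (hsqint.add (hcacint.const_mul _)) hconst,
    integral_add' hsqint (hcacint.const_mul _), integral_const_mul, hcac0,
    hw.integral_sq_eq_zero hf hkH hkc, integral_indicator measurableSet_Icc, setIntegral_const,
    Real.volume_real_Icc_of_le (by linarith), smul_eq_mul] at hle
  linarith

lemma IsWeakSolution.integral_sq_le (hw : F.IsWeakSolution f) (hF : F.IsBounded M)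
    (hη : IsCutoff η R δ) (hR : 0 ≤ R) (hf : IsH2Loc f) (hδ : δ ≤ 1 / 16)
    (hC : ∀ x, |f x| ≤ C) :
    ∫ x in -R..R, F.sq f f x ≤ 16 * R * (cutoffConst M C * δ ^ 2) := by
  calc ∫ x in -R..R, F.sq f f x
    _ = ∫ x in Ioc (-R) R, η x ^ 4 * F.sq f f x := by
      rw [intervalIntegral.integral_of_le (by linarith)]
      refine setIntegral_congr_fun measurableSet_Ioc fun x hx => ?_
      simp only [hη.eq_one x (abs_le.2 ⟨hx.1.le, hx.2⟩), one_pow, one_mul]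
    _ ≤ ∫ x, η x ^ 4 * F.sq f f x := setIntegral_le_integral
      (hη.integrable_pow_four_mul_sq F hf) <| Eventually.of_forall fun x =>
        mul_nonneg (pow_nonneg (hη.nonneg x) 4) (F.sq_self_nonneg f x)
    _ ≤ 16 * R * (cutoffConst M C * δ ^ 2) :=
      hw.integral_pow_four_mul_sq_le hF hη hR hf hδ hC

/-- Testing with `η⁴ f` for cutoffs `η` at scale `R`, all error terms are of order `R⁻¹`. -/
theorem IsWeakSolution.ae_sq_eq_zero (hw : F.IsWeakSolution f) (hF : F.IsBounded M)
    (hf : IsH2Loc f) (hC : ∀ x, |f x| ≤ C) : F.sq f f =ᵐ[volume] 0 := by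
  obtain ⟨c, hc⟩ := exists_forall_isCutoff
  refine ae_eq_zero_of_frequently_integral_le (F.locallyIntegrable_sq hf hf) (F.sq_self_nonneg f)
    fun ε hε => Eventually.frequently ?_
  have hsmall : Tendsto (fun R : ℝ => c / R) atTop (nhds 0) :=
    tendsto_const_nhds.div_atTop tendsto_id
  have herror : Tendsto (fun R : ℝ => 16 * cutoffConst M C * c ^ 2 / R) atTop (nhds 0) :=
    tendsto_const_nhds.div_atTop tendsto_id
  filter_upwards [eventually_ge_atTop 1,
    hsmall.eventually_le_const (by norm_num : (0 : ℝ) < 1 / 16), herror.eventually_le_const hε]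
    with R hR hδ hRε
  obtain ⟨η, hη⟩ := hc R hR
  have hR0 : 0 < R := one_pos.trans_le hR
  calc ∫ x in -R..R, F.sq f f x
    _ ≤ 16 * R * (cutoffConst M C * (c / R) ^ 2) := hw.integral_sq_le hF hη hR0.le hf hδ hC
    _ = 16 * cutoffConst M C * c ^ 2 / R := by field_simp
    _ ≤ ε := hRε

end SquareForm

/-! ### The two quadratic forms at the wave -/

namespace SquareForm

variable {F : SquareForm} {f k : ℝ → ℝ} {M : ℝ}

lemma hasDerivAt_deriv_of_ae_P_eq_zero (hf : IsH2Loc f) (hP : F.P f =ᵐ[volume] 0) (x : ℝ) :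
    HasDerivAt (deriv f) (-(F.g x * deriv f x + F.q x * f x)) x := by
  refine (hf.isPrim.congr_ae (hP.mono fun x hx => ?_)).hasDerivAt
    ((F.contDiff_g.continuous.mul hf.continuous_deriv).add
      (F.contDiff_q.continuous.mul hf.continuous)).neg x
  exact eq_neg_of_add_eq_zero_left ((add_assoc _ _ _).symm.trans hx)

/-- The vector field on the phase plane whose trajectories `(f, f')` are the solutions of
`P f = 0`. -/
def phaseField (F : SquareForm) (t : ℝ) (p : ℝ × ℝ) : ℝ × ℝ :=
  (p.2, -(F.g t * p.2 + F.q t * p.1))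

lemma IsBounded.lipschitzWith_phaseField (hF : F.IsBounded M) (t : ℝ) :
    LipschitzWith (Real.toNNReal (1 + 2 * M)) (F.phaseField t) := by
  have hM : 0 ≤ M := (abs_nonneg _).trans (hF.abs_g_le 0)
  refine LipschitzWith.of_dist_le_mul fun p p' => ?_
  rw [Real.coe_toNNReal _ (by positivity), Prod.dist_eq, Prod.dist_eq]
  simp only [phaseField, Real.dist_eq]
  set m := max |p.1 - p'.1| |p.2 - p'.2|
  have h₁ : |p.1 - p'.1| ≤ m := le_max_left _ _
  have h₂ : |p.2 - p'.2| ≤ m := le_max_right _ _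
  have hm : 0 ≤ m := (abs_nonneg _).trans h₁
  refine max_le (h₂.trans (le_mul_of_one_le_left hm (by linarith))) ?_
  calc |-(F.g t * p.2 + F.q t * p.1) - -(F.g t * p'.2 + F.q t * p'.1)|
    _ = |F.g t * (p.2 - p'.2) + F.q t * (p.1 - p'.1)| := by
      rw [← abs_neg]
      congr 1
      ring
    _ ≤ |F.g t| * |p.2 - p'.2| + |F.q t| * |p.1 - p'.1| := by
      simpa only [abs_mul] using abs_add_le (F.g t * (p.2 - p'.2)) (F.q t * (p.1 - p'.1))
    _ ≤ M * m + M * m := by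
      gcongr
      exacts [hF.abs_g_le t, hF.abs_q_le t]
    _ ≤ (1 + 2 * M) * m := by linarith

lemma eq_of_ae_P_eq_zero (hF : F.IsBounded M) (hf : IsH2Loc f) (hk : IsH2Loc k)
    (hPf : F.P f =ᵐ[volume] 0) (hPk : F.P k =ᵐ[volume] 0) (h₀ : f 0 = k 0)
    (h₁ : deriv f 0 = deriv k 0) : f = k := by
  have hsol {j : ℝ → ℝ} (hj : IsH2Loc j) (hP : F.P j =ᵐ[volume] 0) (t : ℝ) :
      HasDerivAt (fun x => (j x, deriv j x)) (F.phaseField t (j t, deriv j t)) t ∧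
        (j t, deriv j t) ∈ univ :=
    ⟨(hj.hasDerivAt t).prodMk (hasDerivAt_deriv_of_ae_P_eq_zero hj hP t), mem_univ _⟩
  have huniq := ODE_solution_unique_univ (t₀ := 0)
    (fun t => (hF.lipschitzWith_phaseField t).lipschitzOnWith) (hsol hf hPf) (hsol hk hPk)
    (by rw [h₀, h₁])
  exact funext fun x => congrArg Prod.fst (congrFun huniq x)

lemma ae_P_eq_zero_of_ae_sq_eq_zero (h : F.sq f f =ᵐ[volume] 0) : F.P f =ᵐ[volume] 0 :=
  h.mono fun x hx => ((F.sq_self_eq_zero_iff f x).1 hx).1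

lemma Z_eq_zero_of_ae_sq_eq_zero (hf : IsH2Loc f) (h : F.sq f f =ᵐ[volume] 0) : F.Z f = 0 :=
  ((F.continuous_Z hf).ae_eq_iff_eq volume continuous_zero).1
    (h.mono fun x hx => ((F.sq_self_eq_zero_iff f x).1 hx).2)

end SquareForm

/-- Half of the second variation of the density of `Λ_c` at `u₀ = U` in the real directions `f`
and `k`, where `V = U'`. -/
def realVariation (ℰ c : ℝ) (U V f k : ℝ → ℝ) (x : ℝ) : ℝ :=
  deriv (deriv f) x * deriv (deriv k) x + (5 * U x ^ 2 - c) * (deriv f x * deriv k x)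
    + 10 * (U x * V x) * (f x * deriv k x + deriv f x * k x)
    + (5 * V x ^ 2 + 15 / 2 * U x ^ 4 - (3 - ℰ ^ 2) / 2 - c * (3 * U x ^ 2 - 1)) * (f x * k x)

/-- Half of the second variation of the density of `Λ_c` at `u₀ = U` in the imaginary directions
`i f` and `i k`, where `V = U'`. -/
def imagVariation (ℰ c : ℝ) (U V f k : ℝ → ℝ) (x : ℝ) : ℝ :=
  deriv (deriv f) x * deriv (deriv k) x + (3 * U x ^ 2 - c) * (deriv f x * deriv k x)
    + 2 * (U x * V x) * (f x * deriv k x + deriv f x * k x)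
    + (3 * V x ^ 2 + 3 / 2 * U x ^ 4 - (3 - ℰ ^ 2) / 2 - c * (U x ^ 2 - 1)) * (f x * k x)

namespace IsCnoidal

variable {ℰ T : ℝ} {U V f k : ℝ → ℝ}

lemma deriv_eq (H : IsCnoidal ℰ T U V) : deriv U = V := funext fun x => (H.hasDerivAt x).deriv

lemma deriv_eq' (H : IsCnoidal ℰ T U V) : deriv V = fun x => U x ^ 3 - U x :=
  funext fun x => (H.hasDerivAt' x).deriv

lemma contDiff_nat (H : IsCnoidal ℰ T U V) (n : ℕ) : ContDiff ℝ n U ∧ ContDiff ℝ n V := by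
  have hU : Differentiable ℝ U := fun x => (H.hasDerivAt x).differentiableAt
  have hV : Differentiable ℝ V := fun x => (H.hasDerivAt' x).differentiableAt
  induction n with
  | zero => exact ⟨contDiff_zero.2 hU.continuous, contDiff_zero.2 hV.continuous⟩
  | succ n ih =>
    push_cast
    rw [contDiff_succ_iff_deriv, contDiff_succ_iff_deriv, H.deriv_eq, H.deriv_eq']
    exact ⟨⟨hU, by simp, ih.2⟩, hV, by simp, (ih.1.pow 3).sub ih.1⟩

lemma contDiff (H : IsCnoidal ℰ T U V) : ContDiff ℝ 2 U := (H.contDiff_nat 2).1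

lemma contDiff' (H : IsCnoidal ℰ T U V) : ContDiff ℝ 2 V := (H.contDiff_nat 2).2

lemma periodic' (H : IsCnoidal ℰ T U V) : Function.Periodic V T := by
  simpa only [H.deriv_eq] using periodic_deriv H.periodic

lemma one_sub_sq_ne_zero (H : IsCnoidal ℰ T U V) (x : ℝ) : 1 - U x ^ 2 ≠ 0 :=
  (H.pos.trans_le (H.le x)).ne'

lemma deriv_zero_ne_zero (H : IsCnoidal ℰ T U V) : V 0 ≠ 0 := fun h₀ => by
  have hI := H.first_integral 0
  rw [h₀, H.zero] at hI
  nlinarith [H.pos, H.lt_one]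

/-- The quotient `U' / (1 - U²)`. -/
def ratio (U V : ℝ → ℝ) (x : ℝ) : ℝ := V x / (1 - U x ^ 2)

lemma eq_ratio_mul (H : IsCnoidal ℰ T U V) (x : ℝ) : V x = ratio U V x * (1 - U x ^ 2) :=
  (div_mul_cancel₀ _ (H.one_sub_sq_ne_zero x)).symm

lemma contDiff_ratio (H : IsCnoidal ℰ T U V) : ContDiff ℝ 2 (ratio U V) :=
  H.contDiff'.div (contDiff_const.sub (H.contDiff.pow 2)) H.one_sub_sq_ne_zero

lemma periodic_ratio (H : IsCnoidal ℰ T U V) : Function.Periodic (ratio U V) T := fun x => by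
  rw [ratio, H.periodic x, H.periodic' x, ratio]

lemma hasDerivAt_ratio (H : IsCnoidal ℰ T U V) (x : ℝ) :
    HasDerivAt (ratio U V) (-U x + 2 * U x * ratio U V x ^ 2) x := by
  have hne := H.one_sub_sq_ne_zero x
  refine ((H.hasDerivAt' x).fun_div (((H.hasDerivAt x).fun_pow 2).const_sub 1) hne).congr_deriv ?_
  rw [ratio]
  field_simp
  push_cast
  ring

/-- The form acting on the real part of a perturbation: its operators annihilate `u₀' = V`, and its
density after integration by parts is `realVariation ℰ 2 U V`. -/
def plusForm (H : IsCnoidal ℰ T U V) : SquareForm where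
  g x := U x * ratio U V x
  q x := 1 - 2 * U x ^ 2
  r := ratio U V
  s := U
  γ x := 4 * (U x * V x)
  contDiff_g := (H.contDiff.mul H.contDiff_ratio).of_le one_le_two
  contDiff_q := (contDiff_const.sub (contDiff_const.mul (H.contDiff.pow 2))).of_le one_le_two
  contDiff_γ := (contDiff_const.mul (H.contDiff.mul H.contDiff')).of_le one_le_two
  continuous_r := H.contDiff_ratio.continuous
  continuous_s := H.contDiff.continuous

/-- The form acting on the imaginary part of a perturbation: its operators annihilate `u₀ = U`, and
its density after integration by parts is `imagVariation ℰ 2 U V`. -/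
def minusForm (H : IsCnoidal ℰ T U V) : SquareForm where
  g _ := 0
  q x := 1 - U x ^ 2
  r := U
  s x := -V x
  γ x := U x * V x
  contDiff_g := contDiff_const
  contDiff_q := (contDiff_const.sub (H.contDiff.pow 2)).of_le one_le_two
  contDiff_γ := (H.contDiff.mul H.contDiff').of_le one_le_two
  continuous_r := H.contDiff.continuous
  continuous_s := H.contDiff'.continuous.neg

lemma isPeriodic_plusForm (H : IsCnoidal ℰ T U V) : H.plusForm.IsPeriodic T where
  pos := H.period_pos
  g := H.periodic.mul H.periodic_ratio
  q x := by simp only [plusForm, H.periodic x]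
  r := H.periodic_ratio
  s := H.periodic
  γ x := by simp only [plusForm, H.periodic x, H.periodic' x]

lemma isPeriodic_minusForm (H : IsCnoidal ℰ T U V) : H.minusForm.IsPeriodic T where
  pos := H.period_pos
  g _ := rfl
  q x := by simp only [minusForm, H.periodic x]
  r := H.periodic
  s x := by simp only [minusForm, H.periodic' x]
  γ := H.periodic.mul H.periodic'

lemma hasDerivAt_mul (H : IsCnoidal ℰ T U V) (x : ℝ) :
    HasDerivAt (fun x => U x * V x) (V x ^ 2 + U x * (U x ^ 3 - U x)) x :=
  ((H.hasDerivAt x).fun_mul (H.hasDerivAt' x)).congr_deriv (by ring)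

lemma form_plusForm (H : IsCnoidal ℰ T U V) (f k : ℝ → ℝ) :
    H.plusForm.form f k = realVariation ℰ 2 U V f k := funext fun x => by
  have hg : deriv H.plusForm.g x = _ := ((H.hasDerivAt x).fun_mul (H.hasDerivAt_ratio x)).deriv
  have hq : deriv H.plusForm.q x = _ :=
    ((((H.hasDerivAt x).fun_pow 2).const_mul 2).const_sub 1).deriv
  have hγ : deriv H.plusForm.γ x = _ := ((H.hasDerivAt_mul x).const_mul 4).deriv
  rw [SquareForm.form, SquareForm.coeffOne, SquareForm.coeffMixed, SquareForm.coeffZero, hg, hq, hγ,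
    realVariation]
  simp only [plusForm]
  push_cast
  linear_combination (-ratio U V x * (deriv f x * deriv k x)
    - 2 * U x * (f x * deriv k x + deriv f x * k x)) * H.eq_ratio_mul x
    - (f x * k x) * H.first_integral x

lemma form_minusForm (H : IsCnoidal ℰ T U V) (f k : ℝ → ℝ) :
    H.minusForm.form f k = imagVariation ℰ 2 U V f k := funext fun x => by
  have hg : deriv H.minusForm.g x = _ := (hasDerivAt_const x (0 : ℝ)).deriv
  have hq : deriv H.minusForm.q x = _ := (((H.hasDerivAt x).fun_pow 2).const_sub 1).deriv
  have hγ : deriv H.minusForm.γ x = _ := (H.hasDerivAt_mul x).deriv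
  rw [SquareForm.form, SquareForm.coeffOne, SquareForm.coeffMixed, SquareForm.coeffZero, hg, hq, hγ,
    imagVariation]
  simp only [minusForm]
  push_cast
  linear_combination -(f x * k x) * H.first_integral x

lemma deriv_const_mul (H : IsCnoidal ℰ T U V) (b : ℝ) :
    (deriv fun x => b * U x) = fun x => b * V x :=
  funext fun x => ((H.hasDerivAt x).const_mul b).deriv

lemma deriv_const_mul' (H : IsCnoidal ℰ T U V) (a : ℝ) :
    (deriv fun x => a * V x) = fun x => a * (U x ^ 3 - U x) :=
  funext fun x => ((H.hasDerivAt' x).const_mul a).deriv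

lemma deriv_deriv_const_mul' (H : IsCnoidal ℰ T U V) (a : ℝ) :
    (deriv (deriv fun x => a * V x)) = fun x => a * ((3 * U x ^ 2 - 1) * V x) :=
  funext fun x => by
    rw [H.deriv_const_mul', ((((H.hasDerivAt x).fun_pow 3).fun_sub
      (H.hasDerivAt x)).const_mul a).deriv]
    push_cast
    ring

lemma sq_plusForm_const_mul (H : IsCnoidal ℰ T U V) (a : ℝ) (f : ℝ → ℝ) :
    H.plusForm.sq (fun x => a * V x) f = 0 := funext fun x => by
  have hP : H.plusForm.P (fun x => a * V x) x = 0 := by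
    rw [SquareForm.P, H.deriv_deriv_const_mul', H.deriv_const_mul']
    simp only [plusForm]
    linear_combination (a * U x ^ 2) * H.eq_ratio_mul x
  have hZ : H.plusForm.Z (fun x => a * V x) x = 0 := by
    simp only [SquareForm.Z, H.deriv_const_mul', plusForm]
    linear_combination (a * U x) * H.eq_ratio_mul x
  rw [SquareForm.sq, hP, hZ, zero_mul, zero_mul, add_zero, Pi.zero_apply]

lemma sq_minusForm_const_mul (H : IsCnoidal ℰ T U V) (b : ℝ) (f : ℝ → ℝ) :
    H.minusForm.sq (fun x => b * U x) f = 0 := funext fun x => by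
  simp only [SquareForm.sq, SquareForm.P, SquareForm.Z, H.deriv_const_mul, H.deriv_const_mul',
    minusForm, Pi.zero_apply]
  ring

lemma exists_eq_const_mul_deriv (H : IsCnoidal ℰ T U V) (hf : IsH2Loc f)
    (h : H.plusForm.sq f f =ᵐ[volume] 0) : ∃ a : ℝ, f = fun x => a * V x := by
  have hd : deriv f 0 = 0 := by
    have hZ : ratio U V 0 * deriv f 0 + U 0 * f 0 = 0 :=
      congrFun (SquareForm.Z_eq_zero_of_ae_sq_eq_zero hf h) 0
    rw [ratio, H.zero, zero_mul, add_zero] at hZ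
    simpa [H.deriv_zero_ne_zero] using hZ
  obtain ⟨M, hM⟩ := H.isPeriodic_plusForm.exists_isBounded
  refine ⟨f 0 / V 0, SquareForm.eq_of_ae_P_eq_zero hM hf
    (.of_contDiff (contDiff_const.mul H.contDiff')) (SquareForm.ae_P_eq_zero_of_ae_sq_eq_zero h)
    (SquareForm.ae_P_eq_zero_of_ae_sq_eq_zero (H.sq_plusForm_const_mul _ _).eventuallyEq) ?_ ?_⟩
  · exact (div_mul_cancel₀ _ H.deriv_zero_ne_zero).symm
  · simp only [hd, H.deriv_const_mul', H.zero]
    ring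

lemma exists_eq_const_mul (H : IsCnoidal ℰ T U V) (hf : IsH2Loc f)
    (h : H.minusForm.sq f f =ᵐ[volume] 0) : ∃ b : ℝ, f = fun x => b * U x := by
  have h₀ : f 0 = 0 := by
    have hZ : U 0 * deriv f 0 + -V 0 * f 0 = 0 :=
      congrFun (SquareForm.Z_eq_zero_of_ae_sq_eq_zero hf h) 0
    rw [H.zero, zero_mul, zero_add] at hZ
    simpa [H.deriv_zero_ne_zero] using hZ
  obtain ⟨M, hM⟩ := H.isPeriodic_minusForm.exists_isBounded
  refine ⟨deriv f 0 / V 0, SquareForm.eq_of_ae_P_eq_zero hM hf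
    (.of_contDiff (contDiff_const.mul H.contDiff)) (SquareForm.ae_P_eq_zero_of_ae_sq_eq_zero h)
    (SquareForm.ae_P_eq_zero_of_ae_sq_eq_zero (H.sq_minusForm_const_mul _ _).eventuallyEq) ?_ ?_⟩
  · rw [h₀, H.zero, mul_zero]
  · rw [H.deriv_const_mul]
    exact (div_mul_cancel₀ _ H.deriv_zero_ne_zero).symm

end IsCnoidal

/-! ### The second variation -/

lemma iteratedDeriv_integral_sum_mul_pow {c : ℕ → ℝ → ℝ} {a b : ℝ} {m n : ℕ}
    (hc : ∀ k, IntervalIntegrable (c k) volume a b) (hm : m < n) :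
    iteratedDeriv m (fun ε => ∫ x in a..b, ∑ k ∈ Finset.range n, c k x * ε ^ k) 0 =
      m.factorial * ∫ x in a..b, c m x := by
  have hpoly (ε : ℝ) : ∫ x in a..b, ∑ k ∈ Finset.range n, c k x * ε ^ k =
      ∑ k ∈ Finset.range n, (∫ x in a..b, c k x) * ε ^ k := by
    rw [intervalIntegral.integral_finsetSum fun k _ => (hc k).mul_const _]
    simp only [intervalIntegral.integral_mul_const]
  simp only [hpoly]
  rw [iteratedDeriv_fun_sum fun k _ => by fun_prop]
  simp only [iteratedDeriv_const_mul_field, iteratedDeriv_fun_pow_zero]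
  rw [Finset.sum_eq_single_of_mem m (Finset.mem_range.2 hm) fun k _ hk => by simp [hk.symm]]
  simp [mul_comm]

section Density

lemma sq_norm_eq (z : ℂ) : ‖z‖ ^ 2 = z.re ^ 2 + z.im ^ 2 := by
  rw [Complex.sq_norm, Complex.normSq_apply, sq, sq]

lemma lyapunovDensity_eq (ℰ c : ℝ) (p p₁ p₂ : ℂ) : lyapunovDensity ℰ c p p₁ p₂ =
    (p₂.re ^ 2 + p₂.im ^ 2) + 3 * ((p.re ^ 2 + p.im ^ 2) * (p₁.re ^ 2 + p₁.im ^ 2))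
      + 2 * (p.re * p₁.re + p.im * p₁.im) ^ 2 + 1 / 2 * (p.re ^ 2 + p.im ^ 2) ^ 3
      - 1 / 2 * (3 - ℰ ^ 2) * (p.re ^ 2 + p.im ^ 2)
      - c * ((p₁.re ^ 2 + p₁.im ^ 2) + 1 / 2 * (1 - (p.re ^ 2 + p.im ^ 2)) ^ 2) := by
  simp only [lyapunovDensity, higherDensity, chargeDensity, energyDensity]
  rw [show ‖p‖ ^ 6 = (‖p‖ ^ 2) ^ 3 by ring, sq_norm_eq, sq_norm_eq, sq_norm_eq]
  simp only [Complex.mul_re, Complex.conj_re, Complex.conj_im]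
  ring

lemma hasDerivAt_add_mul (x a : ℝ) : HasDerivAt (fun t : ℝ => x + t * a) a 0 :=
  (hasDerivAt_mul_const a).const_add x

lemma deriv_lyapunovDensity (ℰ c : ℝ) (p p₁ p₂ b b₁ b₂ : ℂ) :
    deriv (fun t : ℝ => lyapunovDensity ℰ c (p + t * b) (p₁ + t * b₁) (p₂ + t * b₂)) 0 =
      2 * (p₂.re * b₂.re + p₂.im * b₂.im)
        + 6 * ((p.re * b.re + p.im * b.im) * (p₁.re ^ 2 + p₁.im ^ 2)
          + (p.re ^ 2 + p.im ^ 2) * (p₁.re * b₁.re + p₁.im * b₁.im))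
        + 4 * ((p.re * p₁.re + p.im * p₁.im)
          * (p.re * b₁.re + p₁.re * b.re + (p.im * b₁.im + p₁.im * b.im)))
        + 3 * ((p.re ^ 2 + p.im ^ 2) ^ 2 * (p.re * b.re + p.im * b.im))
        - (3 - ℰ ^ 2) * (p.re * b.re + p.im * b.im)
        - 2 * c * ((p₁.re * b₁.re + p₁.im * b₁.im)
          - (1 - (p.re ^ 2 + p.im ^ 2)) * (p.re * b.re + p.im * b.im)) := by
  simp only [lyapunovDensity_eq, Complex.add_re, Complex.add_im, Complex.re_ofReal_mul,
    Complex.im_ofReal_mul]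
  have hre := hasDerivAt_add_mul p.re b.re
  have him := hasDerivAt_add_mul p.im b.im
  have hre₁ := hasDerivAt_add_mul p₁.re b₁.re
  have him₁ := hasDerivAt_add_mul p₁.im b₁.im
  have hsq := (hre.fun_pow 2).fun_add (him.fun_pow 2)
  have hsq₁ := (hre₁.fun_pow 2).fun_add (him₁.fun_pow 2)
  have hsq₂ := ((hasDerivAt_add_mul p₂.re b₂.re).fun_pow 2).fun_add
    ((hasDerivAt_add_mul p₂.im b₂.im).fun_pow 2)
  have hinner := (hre.fun_mul hre₁).fun_add (him.fun_mul him₁)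
  refine (((((hsq₂.fun_add ((hsq.fun_mul hsq₁).const_mul 3)).fun_add
    ((hinner.fun_pow 2).const_mul 2)).fun_add ((hsq.fun_pow 3).const_mul (1 / 2))).fun_sub
    (hsq.const_mul (1 / 2 * (3 - ℰ ^ 2)))).fun_sub
    ((hsq₁.fun_add (((hsq.const_sub 1).fun_pow 2).const_mul (1 / 2))).const_mul c)).deriv.trans ?_
  push_cast
  ring

lemma deriv_deriv_lyapunovDensity (ℰ c u v v' : ℝ) (a a₁ a₂ b b₁ b₂ : ℂ) :
    deriv (fun s : ℝ => deriv (fun t : ℝ => lyapunovDensity ℰ c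
      ((u : ℂ) + s * a + t * b) ((v : ℂ) + s * a₁ + t * b₁) ((v' : ℂ) + s * a₂ + t * b₂)) 0) 0 =
    2 * ((a₂.re * b₂.re + (5 * u ^ 2 - c) * (a₁.re * b₁.re)
        + 10 * (u * v) * (a.re * b₁.re + a₁.re * b.re)
        + (5 * v ^ 2 + 15 / 2 * u ^ 4 - (3 - ℰ ^ 2) / 2 - c * (3 * u ^ 2 - 1)) * (a.re * b.re))
      + (a₂.im * b₂.im + (3 * u ^ 2 - c) * (a₁.im * b₁.im)
        + 2 * (u * v) * (a.im * b₁.im + a₁.im * b.im)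
        + (3 * v ^ 2 + 3 / 2 * u ^ 4 - (3 - ℰ ^ 2) / 2 - c * (u ^ 2 - 1)) * (a.im * b.im))) := by
  simp only [deriv_lyapunovDensity, Complex.add_re, Complex.add_im, Complex.re_ofReal_mul,
    Complex.im_ofReal_mul, Complex.ofReal_re, Complex.ofReal_im]
  have hre := hasDerivAt_add_mul u a.re
  have him := hasDerivAt_add_mul 0 a.im
  have hre₁ := hasDerivAt_add_mul v a₁.re
  have him₁ := hasDerivAt_add_mul 0 a₁.im
  have hsq := (hre.fun_pow 2).fun_add (him.fun_pow 2)
  have hsq₁ := (hre₁.fun_pow 2).fun_add (him₁.fun_pow 2)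
  have hinner := (hre.fun_mul hre₁).fun_add (him.fun_mul him₁)
  have hb := (hre.mul_const b.re).fun_add (him.mul_const b.im)
  have hb₁ := (hre₁.mul_const b₁.re).fun_add (him₁.mul_const b₁.im)
  have hb₂ := ((hasDerivAt_add_mul v' a₂.re).mul_const b₂.re).fun_add
    ((hasDerivAt_add_mul 0 a₂.im).mul_const b₂.im)
  have hcross := ((hre.mul_const b₁.re).fun_add (hre₁.mul_const b.re)).fun_add
    ((him.mul_const b₁.im).fun_add (him₁.mul_const b.im))
  refine ((((((hb₂.const_mul 2).fun_add
    (((hb.fun_mul hsq₁).fun_add (hsq.fun_mul hb₁)).const_mul 6)).fun_add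
    ((hinner.fun_mul hcross).const_mul 4)).fun_add
    (((hsq.fun_pow 2).fun_mul hb).const_mul 3)).fun_sub (hb.const_mul (3 - ℰ ^ 2))).fun_sub
    ((hb₁.fun_sub ((hsq.const_sub 1).fun_mul hb)).const_mul (2 * c))).deriv.trans ?_
  push_cast
  ring

/-- The coefficient of `ε ^ k` in the density of `Λ_c` at `u₀ + ε (f + i h)`, where `u₀`, `u₀'` and
`u₀''` are denoted by `U`, `V` and `V'`. -/
def lineCoeff (ℰ c : ℝ) (U V V' f h : ℝ → ℝ) : ℕ → ℝ → ℝ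
  | 0, x => V' x ^ 2 + 5 * (U x ^ 2 * V x ^ 2) + 1 / 2 * U x ^ 6 - 1 / 2 * (3 - ℰ ^ 2) * U x ^ 2
      - c * (V x ^ 2 + 1 / 2 * (1 - U x ^ 2) ^ 2)
  | 1, x => 2 * V' x * deriv (deriv f) x + (10 * (U x * V x * (U x * deriv f x + V x * f x))
      + 3 * (U x ^ 5 * f x) - (3 - ℰ ^ 2) * (U x * f x)
      - 2 * c * (V x * deriv f x - (1 - U x ^ 2) * (U x * f x)))
  | 2, x => realVariation ℰ c U V f f x + imagVariation ℰ c U V h h x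
  | 3, x => 6 * (U x * f x * (deriv f x ^ 2 + deriv h x ^ 2)
        + V x * deriv f x * (f x ^ 2 + h x ^ 2))
      + 4 * ((U x * deriv f x + V x * f x) * (f x * deriv f x + h x * deriv h x))
      + 6 * (U x ^ 3 * f x * (f x ^ 2 + h x ^ 2)) + 4 * (U x * f x) ^ 3
      - 2 * c * (U x * f x * (f x ^ 2 + h x ^ 2))
  | 4, x => 3 * ((f x ^ 2 + h x ^ 2) * (deriv f x ^ 2 + deriv h x ^ 2))
      + 2 * (f x * deriv f x + h x * deriv h x) ^ 2 + 3 / 2 * (U x ^ 2 * (f x ^ 2 + h x ^ 2) ^ 2)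
      + 6 * ((U x * f x) ^ 2 * (f x ^ 2 + h x ^ 2)) - 1 / 2 * c * (f x ^ 2 + h x ^ 2) ^ 2
  | 5, x => 3 * (U x * f x * (f x ^ 2 + h x ^ 2) ^ 2)
  | 6, x => 1 / 2 * (f x ^ 2 + h x ^ 2) ^ 3
  | _, _ => 0

lemma lyapunovDensity_eq_sum_lineCoeff (ℰ c : ℝ) (U V V' f h : ℝ → ℝ) {a a₁ a₂ : ℂ} {x : ℝ}
    (ha : a = ⟨f x, h x⟩) (ha₁ : a₁ = ⟨deriv f x, deriv h x⟩)
    (ha₂ : a₂ = ⟨deriv (deriv f) x, deriv (deriv h) x⟩) (ε : ℝ) :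
    lyapunovDensity ℰ c ((U x : ℂ) + ε * a) ((V x : ℂ) + ε * a₁) ((V' x : ℂ) + ε * a₂) =
      ∑ k ∈ Finset.range 7, lineCoeff ℰ c U V V' f h k x * ε ^ k := by
  subst ha ha₁ ha₂
  simp only [lyapunovDensity_eq, Complex.add_re, Complex.add_im, Complex.re_ofReal_mul,
    Complex.im_ofReal_mul, Complex.ofReal_re, Complex.ofReal_im, Finset.sum_range_succ,
    Finset.sum_range_zero, lineCoeff, realVariation, imagVariation]
  ring

lemma locallyIntegrable_lineCoeff {ℰ c : ℝ} {U V V' f h : ℝ → ℝ} (hU : Continuous U)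
    (hV : Continuous V) (hV' : Continuous V') (hf : IsH2Loc f) (hh : IsH2Loc h)
    (hre : LocallyIntegrable (realVariation ℰ c U V f f))
    (him : LocallyIntegrable (imagVariation ℰ c U V h h)) :
    ∀ k, LocallyIntegrable (lineCoeff ℰ c U V V' f h k)
  | 0 => Continuous.locallyIntegrable (by unfold lineCoeff; fun_prop)
  | 1 => (hf.isPrim.loc.continuous_mul (continuous_const.mul hV')).add
      (Continuous.locallyIntegrable (by
        have := hf.continuous
        have := hf.continuous_deriv
        fun_prop))
  | 2 => hre.add him
  | 3 | 4 | 5 | 6 => Continuous.locallyIntegrable (by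
      have := hf.continuous
      have := hf.continuous_deriv
      have := hh.continuous
      have := hh.continuous_deriv
      unfold lineCoeff
      fun_prop)
  | _ + 7 => locallyIntegrable_zero

end Density

namespace MemH2Loc

variable {w u : ℝ → ℂ}

lemma hasDerivAt (hw : MemH2Loc w) (x : ℝ) : HasDerivAt w (deriv w x) x :=
  (hw.contDiff.differentiable one_ne_zero x).hasDerivAt

lemma continuous (hw : MemH2Loc w) : Continuous w := hw.contDiff.continuous

lemma continuous_deriv (hw : MemH2Loc w) : Continuous (deriv w) :=
  hw.contDiff.continuous_deriv le_rfl

lemma isPrim (hw : MemH2Loc w) : IsPrim (deriv w) (deriv (deriv w)) :=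
  ⟨fun x => ⟨Icc (x - 1) (x + 1), Icc_mem_nhds (by linarith) (by linarith),
    (hw.memLp (x - 1) (x + 1)).integrable one_le_two⟩, hw.ftc⟩

lemma locallyIntegrable_sq_norm (hw : MemH2Loc w) :
    LocallyIntegrable fun x => ‖deriv (deriv w) x‖ ^ 2 :=
  fun x => ⟨Icc (x - 1) (x + 1), Icc_mem_nhds (by linarith) (by linarith),
    (hw.memLp (x - 1) (x + 1)).norm.integrable_sq⟩

lemma of_isPrim {w₁ w₂ : ℝ → ℂ} (h : ∀ x, HasDerivAt w (w₁ x) x) (h₁ : IsPrim w₁ w₂)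
    (h₂ : ∀ a b : ℝ, MemLp w₂ 2 (volume.restrict (Icc a b))) : MemH2Loc w := by
  have hderiv : deriv w = w₁ := funext fun x => (h x).deriv
  have hae : w₂ =ᵐ[volume] deriv w₁ := h₁.deriv_ae_eq.symm
  refine ⟨contDiff_one_iff_deriv.2 ⟨fun x => (h x).differentiableAt, ?_⟩, fun a b => ?_, ?_⟩ <;>
    rw [hderiv]
  · exact h₁.continuous
  · exact (h₂ a b).ae_eq (ae_restrict_of_ae hae)
  · exact (h₁.congr_ae hae).ftc

lemma of_contDiff (hw : ContDiff ℝ 2 w) : MemH2Loc w := by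
  obtain ⟨hd, -, hw'⟩ := contDiff_succ_iff_deriv.1 (show ContDiff ℝ (1 + 1) w from hw)
  obtain ⟨hd', hc⟩ := contDiff_one_iff_deriv.1 hw'
  refine of_isPrim (fun x => (hd x).hasDerivAt) (.of_hasDerivAt (fun x => (hd' x).hasDerivAt) hc)
    fun a b => ?_
  obtain ⟨C, hC⟩ := (isCompact_Icc (a := a) (b := b)).exists_bound_of_continuousOn hc.continuousOn
  exact .of_bound hc.aestronglyMeasurable C ((ae_restrict_iff' measurableSet_Icc).2 (.of_forall hC))

lemma hasDerivAt_add_const_mul (hu : MemH2Loc u) (hw : MemH2Loc w) (c : ℂ) (x : ℝ) :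
    HasDerivAt (fun x => u x + c * w x) (deriv u x + c * deriv w x) x :=
  (hu.hasDerivAt x).fun_add ((hw.hasDerivAt x).const_mul c)

lemma deriv_add_const_mul (hu : MemH2Loc u) (hw : MemH2Loc w) (c : ℂ) :
    (deriv fun x => u x + c * w x) = fun x => deriv u x + c * deriv w x :=
  funext fun x => (hu.hasDerivAt_add_const_mul hw c x).deriv

lemma isPrim_add_const_mul (hu : MemH2Loc u) (hw : MemH2Loc w) (c : ℂ) :
    IsPrim (fun x => deriv u x + c * deriv w x)
      (fun x => deriv (deriv u) x + c * deriv (deriv w) x) :=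
  hu.isPrim.add (hw.isPrim.clm_comp (ContinuousLinearMap.mul ℝ ℂ c))

lemma deriv_deriv_add_const_mul (hu : MemH2Loc u) (hw : MemH2Loc w) (c : ℂ) :
    (deriv (deriv fun x => u x + c * w x)) =ᵐ[volume]
      fun x => deriv (deriv u) x + c * deriv (deriv w) x := by
  rw [hu.deriv_add_const_mul hw]
  exact (hu.isPrim_add_const_mul hw c).deriv_ae_eq

lemma add_const_mul (hu : MemH2Loc u) (hw : MemH2Loc w) (c : ℂ) :
    MemH2Loc fun x => u x + c * w x :=
  of_isPrim (hu.hasDerivAt_add_const_mul hw c) (hu.isPrim_add_const_mul hw c)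
    fun a b => (hu.memLp a b).add ((hw.memLp a b).const_mul c)

lemma deriv_clm_comp (hw : MemH2Loc w) (L : ℂ →L[ℝ] ℝ) :
    (deriv fun x => L (w x)) = fun x => L (deriv w x) :=
  funext fun x => (L.hasFDerivAt.comp_hasDerivAt x (hw.hasDerivAt x)).deriv

lemma deriv_deriv_clm_comp (hw : MemH2Loc w) (L : ℂ →L[ℝ] ℝ) :
    (deriv (deriv fun x => L (w x))) =ᵐ[volume] fun x => L (deriv (deriv w) x) := by
  rw [hw.deriv_clm_comp]
  exact (hw.isPrim.clm_comp L).deriv_ae_eq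

lemma isH2Loc_clm_comp (hw : MemH2Loc w) (L : ℂ →L[ℝ] ℝ) : IsH2Loc fun x => L (w x) := by
  refine .of_isPrim (fun x => L.hasFDerivAt.comp_hasDerivAt x (hw.hasDerivAt x))
    (hw.isPrim.clm_comp L) ?_
  refine (hw.locallyIntegrable_sq_norm.smul (‖L‖ ^ 2)).mono
    ((L.continuous.comp_aestronglyMeasurable hw.isPrim.loc.aestronglyMeasurable).pow 2)
    (.of_forall fun x => ?_)
  rw [Pi.smul_apply, smul_eq_mul, ← mul_pow, norm_pow, norm_pow, norm_mul, norm_norm, norm_norm]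
  exact pow_le_pow_left₀ (norm_nonneg _) (L.le_opNorm _) 2

lemma isH2Loc_re (hw : MemH2Loc w) : IsH2Loc fun x => (w x).re := hw.isH2Loc_clm_comp Complex.reCLM

lemma isH2Loc_im (hw : MemH2Loc w) : IsH2Loc fun x => (w x).im := hw.isH2Loc_clm_comp Complex.imCLM

lemma deriv_eq (hw : MemH2Loc w) (x : ℝ) :
    deriv w x = ⟨deriv (fun x => (w x).re) x, deriv (fun x => (w x).im) x⟩ :=
  Complex.ext (congrFun (hw.deriv_clm_comp Complex.reCLM) x).symm
    (congrFun (hw.deriv_clm_comp Complex.imCLM) x).symm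

lemma ae_deriv_deriv_eq (hw : MemH2Loc w) : ∀ᵐ x, deriv (deriv w) x =
    ⟨deriv (deriv fun x => (w x).re) x, deriv (deriv fun x => (w x).im) x⟩ := by
  filter_upwards [hw.deriv_deriv_clm_comp Complex.reCLM, hw.deriv_deriv_clm_comp Complex.imCLM]
    with x hre him using Complex.ext hre.symm him.symm

end MemH2Loc

section Functional

variable {ψ : ℝ → ℂ}

lemma locallyIntegrable_higherDensity (hψ : MemH2Loc ψ) :
    LocallyIntegrable fun x => higherDensity (ψ x) (deriv ψ x) (deriv (deriv ψ) x) := by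
  have h₀ := hψ.continuous
  have h₁ := hψ.continuous_deriv
  have hlow : Continuous fun x => 3 * ‖ψ x‖ ^ 2 * ‖deriv ψ x‖ ^ 2
      + 1 / 2 * (2 * (starRingEnd ℂ (ψ x) * deriv ψ x).re) ^ 2 + 1 / 2 * ‖ψ x‖ ^ 6 := by fun_prop
  refine (hψ.locallyIntegrable_sq_norm.add hlow.locallyIntegrable).congr (.of_forall fun x => ?_)
  simp only [higherDensity, Pi.add_apply]
  ring

lemma lyapunov_eq_functional (hψ : MemH2Loc ψ) (ℰ c T : ℝ) :
    lyapunov ℰ c (Ioo 0 T) ψ = functional (lyapunovDensity ℰ c) (Ioo 0 T) ψ := by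
  have h₀ := hψ.continuous
  have h₁ := hψ.continuous_deriv
  have hloc {k : ℝ → ℝ} (hk : LocallyIntegrable k) : IntegrableOn k (Ioo 0 T) :=
    (hk.integrableOn_isCompact isCompact_Icc).mono_set Ioo_subset_Icc_self
  have hQ : IntegrableOn (fun x => chargeDensity (ψ x) (deriv ψ x) (deriv (deriv ψ) x))
      (Ioo 0 T) := hloc (Continuous.locallyIntegrable (by unfold chargeDensity; fun_prop))
  have hE : IntegrableOn (fun x => energyDensity (ψ x) (deriv ψ x) (deriv (deriv ψ) x))
      (Ioo 0 T) := hloc (Continuous.locallyIntegrable (by unfold energyDensity; fun_prop))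
  have hR := hloc (locallyIntegrable_higherDensity hψ)
  simp only [lyapunov, higherS, higherR, chargeQ, energyE, functional, lyapunovDensity]
  rw [integral_sub _ (hE.const_mul _), integral_sub hR (hQ.const_mul _), integral_const_mul,
    integral_const_mul]
  exact hR.sub (hQ.const_mul _)

end Functional

namespace IsCnoidal

variable {ℰ T : ℝ} {V : ℝ → ℝ} {w φ : ℝ → ℂ}

lemma deriv_wave (H : IsCnoidal ℰ T (profile ℰ) V) : deriv (wave ℰ) = fun x => (V x : ℂ) :=
  funext fun x => (H.hasDerivAt x).ofReal_comp.deriv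

lemma deriv_deriv_wave (H : IsCnoidal ℰ T (profile ℰ) V) :
    deriv (deriv (wave ℰ)) = fun x => ((profile ℰ x ^ 3 - profile ℰ x : ℝ) : ℂ) := by
  rw [H.deriv_wave]
  exact funext fun x => (H.hasDerivAt' x).ofReal_comp.deriv

lemma memH2Loc_wave (H : IsCnoidal ℰ T (profile ℰ) V) : MemH2Loc (wave ℰ) :=
  .of_contDiff (Complex.ofRealCLM.contDiff.comp H.contDiff)

lemma secondVariationLine_eq_integral_variation (H : IsCnoidal ℰ T (profile ℰ) V)
    (hw : MemH2Loc w) (hφ : MemH2Loc φ) (c : ℝ) : secondVariationLine ℰ c w φ =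
      ∫ x, 2 * (realVariation ℰ c (profile ℰ) V (fun x => (w x).re) (fun x => (φ x).re) x
        + imagVariation ℰ c (profile ℰ) V (fun x => (w x).im) (fun x => (φ x).im) x) := by
  refine integral_congr_ae ?_
  filter_upwards [hw.ae_deriv_deriv_eq, hφ.ae_deriv_deriv_eq] with x hwx hφx
  rw [hwx, hφx, H.deriv_deriv_wave, H.deriv_wave, hw.deriv_eq x, hφ.deriv_eq x]
  exact deriv_deriv_lyapunovDensity ℰ c _ _ _ _ _ _ _ _ _

lemma secondVariationLine_eq (H : IsCnoidal ℰ T (profile ℰ) V) (hw : MemH2Loc w)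
    (hφ : MemH2Loc φ)
    (hre : Integrable (H.plusForm.form (fun x => (w x).re) fun x => (φ x).re))
    (him : Integrable (H.minusForm.form (fun x => (w x).im) fun x => (φ x).im)) :
    secondVariationLine ℰ 2 w φ =
      2 * ((∫ x, H.plusForm.form (fun x => (w x).re) (fun x => (φ x).re) x)
        + ∫ x, H.minusForm.form (fun x => (w x).im) (fun x => (φ x).im) x) := by
  rw [H.secondVariationLine_eq_integral_variation hw hφ, ← H.form_plusForm, ← H.form_minusForm,
    integral_const_mul, integral_add hre him]

lemma lyapunov_wave_add (H : IsCnoidal ℰ T (profile ℰ) V) (hw : MemH2Loc w) {L : ℝ}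
    (hL : 0 ≤ L) (c ε : ℝ) : lyapunov ℰ c (Ioo 0 L) (fun x => wave ℰ x + ε * w x) =
      ∫ x in 0..L, ∑ k ∈ Finset.range 7, lineCoeff ℰ c (profile ℰ) V
        (fun x => profile ℰ x ^ 3 - profile ℰ x) (fun x => (w x).re) (fun x => (w x).im) k x
          * ε ^ k := by
  rw [lyapunov_eq_functional (H.memH2Loc_wave.add_const_mul hw ε), functional,
    intervalIntegral.integral_of_le hL, integral_Ioc_eq_integral_Ioo]
  refine integral_congr_ae (ae_restrict_of_ae ?_)
  filter_upwards [hw.ae_deriv_deriv_eq, H.memH2Loc_wave.deriv_deriv_add_const_mul hw ε]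
    with x hwx hx
  rw [hx, H.memH2Loc_wave.deriv_add_const_mul hw, H.deriv_deriv_wave, H.deriv_wave]
  exact lyapunovDensity_eq_sum_lineCoeff ℰ c (profile ℰ) V (fun x => profile ℰ x ^ 3 - profile ℰ x)
    (fun x => (w x).re) (fun x => (w x).im) rfl (hw.deriv_eq x) hwx ε

lemma secondVariationPer_eq (H : IsCnoidal ℰ T (profile ℰ) V) (hw : MemH2Loc w) {L : ℝ}
    (hL : 0 ≤ L) : secondVariationPer ℰ 2 L w =
      2 * ((∫ x in 0..L, H.plusForm.form (fun x => (w x).re) (fun x => (w x).re) x)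
        + ∫ x in 0..L, H.minusForm.form (fun x => (w x).im) (fun x => (w x).im) x) := by
  have hre := H.plusForm.locallyIntegrable_form hw.isH2Loc_re hw.isH2Loc_re
  have him := H.minusForm.locallyIntegrable_form hw.isH2Loc_im hw.isH2Loc_im
  have hV' : Continuous fun x => profile ℰ x ^ 3 - profile ℰ x :=
    (H.contDiff.continuous.pow 3).sub H.contDiff.continuous
  rw [← intervalIntegral.integral_add (intervalIntegrable_of_locallyIntegrable hre _ _)
    (intervalIntegrable_of_locallyIntegrable him _ _)]
  simp only [secondVariationPer, H.lyapunov_wave_add hw hL]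
  rw [H.form_plusForm] at hre ⊢
  rw [H.form_minusForm] at him ⊢
  rw [iteratedDeriv_integral_sum_mul_pow (fun k => intervalIntegrable_of_locallyIntegrable
    (locallyIntegrable_lineCoeff H.contDiff.continuous H.contDiff'.continuous hV'
      hw.isH2Loc_re hw.isH2Loc_im hre him k) _ _) (by norm_num), Nat.factorial_two, Nat.cast_two]
  rfl

lemma isNeutral_iff (H : IsCnoidal ℰ T (profile ℰ) V) : IsNeutral ℰ w ↔
    (∃ a : ℝ, (fun x => (w x).re) = fun x => a * V x) ∧
      ∃ b : ℝ, (fun x => (w x).im) = fun x => b * profile ℰ x := by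
  simp only [IsNeutral, H.deriv_wave, wave, Complex.ext_iff, funext_iff]
  simp [forall_and]

lemma isNeutral_iff_ae_sq_eq_zero (H : IsCnoidal ℰ T (profile ℰ) V) (hw : MemH2Loc w) :
    IsNeutral ℰ w ↔
      H.plusForm.sq (fun x => (w x).re) (fun x => (w x).re) =ᵐ[volume] 0 ∧
        H.minusForm.sq (fun x => (w x).im) (fun x => (w x).im) =ᵐ[volume] 0 := by
  refine ⟨fun hn => ?_, fun ⟨hre, him⟩ => H.isNeutral_iff.2
    ⟨H.exists_eq_const_mul_deriv hw.isH2Loc_re hre, H.exists_eq_const_mul hw.isH2Loc_im him⟩⟩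
  obtain ⟨⟨a, ha⟩, b, hb⟩ := H.isNeutral_iff.1 hn
  rw [ha, hb, H.sq_plusForm_const_mul, H.sq_minusForm_const_mul]
  exact ⟨.rfl, .rfl⟩

end IsCnoidal

section Periodic

variable {T : ℝ}

lemma ae_eq_zero_of_periodic_of_integrable {f : ℝ → ℝ} (hT : 0 < T) (hf : Function.Periodic f T)
    (h0 : ∀ x, 0 ≤ f x) (hint : Integrable f) : f =ᵐ[volume] 0 := by
  refine ae_eq_zero_of_periodic_of_integral_eq_zero hT hf hint.locallyIntegrable h0 ?_
  by_contra hne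
  have hpos : 0 < ∫ x in 0..T, f x :=
    (intervalIntegral.integral_nonneg hT.le fun x _ => h0 x).lt_of_ne' hne
  exact not_tendsto_nhds_of_tendsto_atTop
    (hf.tendsto_atTop_intervalIntegral_of_pos hpos hT) _
    (intervalIntegral_tendsto_integral_Ioi 0 hint.integrableOn tendsto_id)

lemma eq_zero_of_periodic_of_memLp_two {E : Type*} [NormedAddCommGroup E] {f : ℝ → E}
    (hT : 0 < T) (hf : Function.Periodic f T) (hc : Continuous f) (h : MemLp f 2) : f = 0 := by
  have hae : (fun x => ‖f x‖ ^ 2) =ᵐ[volume] 0 :=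
    ae_eq_zero_of_periodic_of_integrable hT (hf.comp fun z => ‖z‖ ^ 2)
      (fun x => sq_nonneg ‖f x‖) h.norm.integrable_sq
  have hzero := (Continuous.ae_eq_iff_eq volume (by fun_prop) continuous_zero).1 hae
  exact funext fun x => by simpa using congrFun hzero x

end Periodic

namespace MemH2

variable {w : ℝ → ℂ}

lemma memLp_clm_comp (hw : MemH2 w) (L : ℂ →L[ℝ] ℝ) :
    MemLp (fun x => L (w x)) 2 ∧ MemLp (deriv fun x => L (w x)) 2 ∧
      MemLp (deriv (deriv fun x => L (w x))) 2 := by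
  refine ⟨L.comp_memLp' hw.memLp_zero, ?_, ?_⟩
  · rw [hw.deriv_clm_comp]
    exact L.comp_memLp' hw.memLp_one
  · exact (memLp_congr_ae (hw.deriv_deriv_clm_comp L)).2 (L.comp_memLp' hw.memLp_two)

end MemH2

lemma SquareForm.IsPeriodic.integral_form_self_eq_integral_sq {F : SquareForm} {f : ℝ → ℝ} {T : ℝ}
    (hF : F.IsPeriodic T) (hf : IsH2Loc f) (h0 : MemLp f 2) (h1 : MemLp (deriv f) 2)
    (h2 : MemLp (deriv (deriv f)) 2) : ∫ x, F.form f f x = ∫ x, F.sq f f x :=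
  F.integral_form_eq_integral_sq hf hf (hF.integrable_boundary h0 h1)
    (hF.integrable_form h0 h1 h2) (hF.integrable_sq h0 h1 h2)

namespace IsCnoidal

variable {ℰ T : ℝ} {V : ℝ → ℝ} {w φ : ℝ → ℂ}

lemma periodic_of_isNeutral (H : IsCnoidal ℰ T (profile ℰ) V) (hn : IsNeutral ℰ w) :
    Function.Periodic w T := fun x => by
  obtain ⟨a, b, hab⟩ := hn
  simp only [hab, H.deriv_wave, wave, H.periodic x, H.periodic' x]

lemma secondVariationPer_eq_integral_sq (H : IsCnoidal ℰ T (profile ℰ) V) {N : ℕ} (hN : 1 ≤ N)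
    (hw : MemH2Per (N * T) w) : secondVariationPer ℰ 2 (N * T) w =
      2 * ((∫ x in 0..N * T, H.plusForm.sq (fun x => (w x).re) (fun x => (w x).re) x)
        + ∫ x in 0..N * T, H.minusForm.sq (fun x => (w x).im) (fun x => (w x).im) x) := by
  have hplus := H.isPeriodic_plusForm.nat_mul hN
  have hminus := H.isPeriodic_minusForm.nat_mul hN
  have hre := hw.periodic.comp Complex.re
  have him := hw.periodic.comp Complex.im
  rw [H.secondVariationPer_eq hw.toMemH2Loc hplus.pos.le,
    hplus.integral_form_eq_integral_sq hw.isH2Loc_re hw.isH2Loc_re hre hre,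
    hminus.integral_form_eq_integral_sq hw.isH2Loc_im hw.isH2Loc_im him him]

lemma secondVariationPer_nonneg (H : IsCnoidal ℰ T (profile ℰ) V) {N : ℕ} (hN : 1 ≤ N)
    (hw : MemH2Per (N * T) w) : 0 ≤ secondVariationPer ℰ 2 (N * T) w := by
  have hL := (H.isPeriodic_plusForm.nat_mul hN).pos.le
  rw [H.secondVariationPer_eq_integral_sq hN hw]
  exact mul_nonneg zero_le_two (add_nonneg
    (intervalIntegral.integral_nonneg hL fun x _ => H.plusForm.sq_self_nonneg _ x)
    (intervalIntegral.integral_nonneg hL fun x _ => H.minusForm.sq_self_nonneg _ x))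

lemma secondVariationPer_eq_zero_iff (H : IsCnoidal ℰ T (profile ℰ) V) {N : ℕ} (hN : 1 ≤ N)
    (hw : MemH2Per (N * T) w) :
    secondVariationPer ℰ 2 (N * T) w = 0 ↔ IsNeutral ℰ w := by
  have hplus := H.isPeriodic_plusForm.nat_mul hN
  have hminus := H.isPeriodic_minusForm.nat_mul hN
  rw [H.isNeutral_iff_ae_sq_eq_zero hw.toMemH2Loc, H.secondVariationPer_eq_integral_sq hN hw,
    mul_eq_zero_iff_left two_ne_zero, add_eq_zero_iff_of_nonneg
      (intervalIntegral.integral_nonneg hplus.pos.le fun x _ => H.plusForm.sq_self_nonneg _ x)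
      (intervalIntegral.integral_nonneg hminus.pos.le fun x _ => H.minusForm.sq_self_nonneg _ x)]
  exact and_congr
    (hplus.integral_sq_eq_zero_iff hw.isH2Loc_re (hw.periodic.comp Complex.re))
    (hminus.integral_sq_eq_zero_iff hw.isH2Loc_im (hw.periodic.comp Complex.im))

lemma secondVariationLine_eq_integral_sq (H : IsCnoidal ℰ T (profile ℰ) V) (hw : MemH2 w) :
    secondVariationLine ℰ 2 w w =
      2 * ((∫ x, H.plusForm.sq (fun x => (w x).re) (fun x => (w x).re) x)
        + ∫ x, H.minusForm.sq (fun x => (w x).im) (fun x => (w x).im) x) := by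
  obtain ⟨hre, hre₁, hre₂⟩ := hw.memLp_clm_comp Complex.reCLM
  obtain ⟨him, him₁, him₂⟩ := hw.memLp_clm_comp Complex.imCLM
  rw [H.secondVariationLine_eq hw.toMemH2Loc hw.toMemH2Loc
      (H.isPeriodic_plusForm.integrable_form hre hre₁ hre₂)
      (H.isPeriodic_minusForm.integrable_form him him₁ him₂)]
  congr 2
  · exact H.isPeriodic_plusForm.integral_form_self_eq_integral_sq hw.isH2Loc_re hre hre₁ hre₂
  · exact H.isPeriodic_minusForm.integral_form_self_eq_integral_sq hw.isH2Loc_im him him₁ him₂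

lemma secondVariationLine_pos (H : IsCnoidal ℰ T (profile ℰ) V) (hw : MemH2 w) (hne : w ≠ 0) :
    0 < secondVariationLine ℰ 2 w w := by
  obtain ⟨hre, hre₁, hre₂⟩ := hw.memLp_clm_comp Complex.reCLM
  obtain ⟨him, him₁, him₂⟩ := hw.memLp_clm_comp Complex.imCLM
  have hplus : 0 ≤ ∫ x, H.plusForm.sq (fun x => (w x).re) (fun x => (w x).re) x :=
    integral_nonneg (H.plusForm.sq_self_nonneg _)
  have hminus : 0 ≤ ∫ x, H.minusForm.sq (fun x => (w x).im) (fun x => (w x).im) x :=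
    integral_nonneg (H.minusForm.sq_self_nonneg _)
  rw [H.secondVariationLine_eq_integral_sq hw]
  refine mul_pos two_pos ((add_nonneg hplus hminus).lt_of_ne' fun hsum => hne ?_)
  rw [add_eq_zero_iff_of_nonneg hplus hminus] at hsum
  have hn : IsNeutral ℰ w := (H.isNeutral_iff_ae_sq_eq_zero hw.toMemH2Loc).2
    ⟨(integral_eq_zero_iff_of_nonneg (H.plusForm.sq_self_nonneg _)
        (H.isPeriodic_plusForm.integrable_sq hre hre₁ hre₂)).1 hsum.1,
      (integral_eq_zero_iff_of_nonneg (H.minusForm.sq_self_nonneg _)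
        (H.isPeriodic_minusForm.integrable_sq him him₁ him₂)).1 hsum.2⟩
  exact eq_zero_of_periodic_of_memLp_two H.period_pos (H.periodic_of_isNeutral hn) hw.continuous
    hw.memLp_zero

lemma secondVariationLine_eq_integral_sq_of_hasCompactSupport
    (H : IsCnoidal ℰ T (profile ℰ) V) (hw : MemH2Loc w) (hφ : MemH2Loc φ)
    (hc : HasCompactSupport φ) : secondVariationLine ℰ 2 w φ =
      2 * ((∫ x, H.plusForm.sq (fun x => (w x).re) (fun x => (φ x).re) x)
        + ∫ x, H.minusForm.sq (fun x => (w x).im) (fun x => (φ x).im) x) := by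
  have hre : HasCompactSupport fun x => (φ x).re := hc.comp_left Complex.zero_re
  have him : HasCompactSupport fun x => (φ x).im := hc.comp_left Complex.zero_im
  rw [H.secondVariationLine_eq hw hφ
      (integrable_of_locallyIntegrable_of_hasCompactSupport
        (H.plusForm.locallyIntegrable_form hw.isH2Loc_re hφ.isH2Loc_re)
        (H.plusForm.hasCompactSupport_form _ hre))
      (integrable_of_locallyIntegrable_of_hasCompactSupport
        (H.minusForm.locallyIntegrable_form hw.isH2Loc_im hφ.isH2Loc_im)
        (H.minusForm.hasCompactSupport_form _ him)),
    H.plusForm.integral_form_eq_integral_sq_of_hasCompactSupport hw.isH2Loc_re hφ.isH2Loc_re hre,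
    H.minusForm.integral_form_eq_integral_sq_of_hasCompactSupport hw.isH2Loc_im hφ.isH2Loc_im him]

lemma isWeakSolution_re_and_im (H : IsCnoidal ℰ T (profile ℰ) V) (hw : MemH2Loc w)
    (h : ∀ φ : ℝ → ℂ, ContDiff ℝ ∞ φ → HasCompactSupport φ → secondVariationLine ℰ 2 w φ = 0) :
    H.plusForm.IsWeakSolution (fun x => (w x).re) ∧
      H.minusForm.IsWeakSolution fun x => (w x).im := by
  have htest (z : ℂ) {ψ : ℝ → ℝ} (hψ : ContDiff ℝ ∞ ψ) (hc : HasCompactSupport ψ) :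
      (∫ x, H.plusForm.sq (fun x => (w x).re) (fun x => (ψ x * z).re) x)
        + ∫ x, H.minusForm.sq (fun x => (w x).im) (fun x => (ψ x * z).im) x = 0 := by
    have hφ : ContDiff ℝ ∞ fun x => (ψ x : ℂ) * z :=
      (Complex.ofRealCLM.contDiff.comp hψ).mul contDiff_const
    have hφc : HasCompactSupport fun x => (ψ x : ℂ) * z :=
      hc.comp_left (g := fun t : ℝ => (t : ℂ) * z) (by simp)
    have hvar := h _ hφ hφc
    rw [H.secondVariationLine_eq_integral_sq_of_hasCompactSupport hw
      (.of_contDiff (contDiff_infty.1 hφ 2)) hφc] at hvar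
    simpa using hvar
  refine ⟨fun ψ hψ hc => ?_, fun ψ hψ hc => ?_⟩
  · simpa [H.minusForm.sq_zero_right] using htest 1 hψ hc
  · simpa [H.plusForm.sq_zero_right] using htest Complex.I hψ hc

lemma secondVariationLine_eq_zero_iff (H : IsCnoidal ℰ T (profile ℰ) V) (hw : MemH2Loc w)
    (hb : ∃ C : ℝ, ∀ x, ‖w x‖ ≤ C) :
    (∀ φ : ℝ → ℂ, ContDiff ℝ ∞ φ → HasCompactSupport φ → secondVariationLine ℰ 2 w φ = 0) ↔
      IsNeutral ℰ w := by
  constructor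
  · intro h
    obtain ⟨hre, him⟩ := H.isWeakSolution_re_and_im hw h
    obtain ⟨C, hC⟩ := hb
    obtain ⟨M, hM⟩ := H.isPeriodic_plusForm.exists_isBounded
    obtain ⟨M', hM'⟩ := H.isPeriodic_minusForm.exists_isBounded
    exact (H.isNeutral_iff_ae_sq_eq_zero hw).2
      ⟨hre.ae_sq_eq_zero hM hw.isH2Loc_re fun x => (Complex.abs_re_le_norm _).trans (hC x),
        him.ae_sq_eq_zero hM' hw.isH2Loc_im fun x => (Complex.abs_im_le_norm _).trans (hC x)⟩
  · intro hn φ hφ hc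
    obtain ⟨⟨a, ha⟩, b, hb⟩ := H.isNeutral_iff.1 hn
    rw [H.secondVariationLine_eq_integral_sq_of_hasCompactSupport hw
      (.of_contDiff (contDiff_infty.1 hφ 2)) hc, ha, hb, H.sq_plusForm_const_mul,
      H.sq_minusForm_const_mul]
    simp only [Pi.zero_apply, integral_zero, add_zero, mul_zero]

end IsCnoidal

end CnoidalNLS

end

theorem proposition3 (ℰ : ℝ) (hℰ₀ : 0 < ℰ) (hℰ₁ : ℰ < 1) :
    -- perturbations whose period is a multiple of the period of the wave
    (∀ N : ℕ, 1 ≤ N → ∀ w : ℝ → ℂ, CnoidalNLS.MemH2Per (N * CnoidalNLS.period ℰ) w →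
      0 ≤ CnoidalNLS.secondVariationPer ℰ 2 (N * CnoidalNLS.period ℰ) w ∧
      (CnoidalNLS.secondVariationPer ℰ 2 (N * CnoidalNLS.period ℰ) w = 0 ↔
        CnoidalNLS.IsNeutral ℰ w)) ∧
    -- localized perturbations
    (∀ w : ℝ → ℂ, CnoidalNLS.MemH2 w → w ≠ 0 →
      0 < CnoidalNLS.secondVariationLine ℰ 2 w w) ∧
    -- the bounded zero modes on the line
    (∀ w : ℝ → ℂ, CnoidalNLS.MemH2Loc w → (∃ C : ℝ, ∀ x, ‖w x‖ ≤ C) →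
      ((∀ φ : ℝ → ℂ, ContDiff ℝ ∞ φ → HasCompactSupport φ →
          CnoidalNLS.secondVariationLine ℰ 2 w φ = 0) ↔
        CnoidalNLS.IsNeutral ℰ w)) := by
  have H := CnoidalNLS.isCnoidal_profile hℰ₀ hℰ₁
  exact ⟨fun _ hN _ hw =>
      ⟨H.secondVariationPer_nonneg hN hw, H.secondVariationPer_eq_zero_iff hN hw⟩,
    fun _ hw hne => H.secondVariationLine_pos hw hne,
    fun _ hw hb => H.secondVariationLine_eq_zero_iff hw hb⟩
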